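/- Let $p$ be a prime, fix an algebraic closure $\overline{\mathbb{Q}}_p$ of $\mathbb{Q}_p$ with its $p$-adic absolute value, and let $\mathbb{Q}_p\subset k\subset K\subset\overline{\mathbb{Q}}_p$ be finite extensions of $\mathbb{Q}_p$. Put $\mathbf{m}=\{x\in\overline{\mathbb{Q}}_p : |x|<1\}$. Let $\mathcal{O}_k$ be the ring of integers of $k$, $q$ the cardinality of its residue field, $\pi$ a uniformizer of $k$, and let $\phi(X)\in\mathcal{O}_k[[X]]$ satisfy $\phi(X)\equiv X^q \bmod \pi$ and $\phi(X)\equiv \pi X \bmod X^2$. Write $\phi^n$ for the $n$-fold composite of $\phi$, and for $a\in\mathcal{O}_k$ let $[a]_\phi\in\mathcal{O}_k[[X]]$ be the unique power series with $[a]_\phi(X)\equiv aX \bmod X^2$ and $\phi\circ[a]_\phi=[a]_\phi\circ\phi$. Let $k_\pi$ be the Lubin--Tate extension of $k$ generated by the torsion points $x\in\mathbf{m}$ with $\phi^n(x)=0$ for some $n\ge 0$, and let $$\widetilde{K}=K\bigl(x\in\mathbf{m} \;\big|\; \phi^n(x)\in K\text{ for some } n\ge 1\bigr).$$ Let $T_\pi=\varprojlim_n\{x\in\mathbf{m}:\phi^n(x)=0\}$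 (with transition maps $\phi$), which is a free $\mathcal{O}_k$-module of rank one with $a\in\mathcal{O}_k$ acting through $[a]_\phi$, and let $\chi_\pi\colon G_k=\mathrm{Gal}(\overline{\mathbb{Q}}_p/k)\to\mathcal{O}_k^\times$ be the Lubin--Tate character giving the action of $G_k$ on $T_\pi$. Let $G_K=\mathrm{Gal}(\overline{\mathbb{Q}}_p/K)\subset G_k$, and let $\mathbb{F},\mathbb{F}_\pi,\widetilde{\mathbb{F}}$ be the residue fields of $K$, $Kk_\pi$ and $\widetilde{K}$. Then $\widetilde{\mathbb{F}}$ is finite. Moreover, there is an integer $t\ge 0$ with $1+p^t\in\chi_\pi(G_K)$, and if $c$ denotes the smallest such $t$, then $[\widetilde{\mathbb{F}}:\mathbb{F}]$ divides $p^c\,[\mathbb{F}_\pi:\mathbb{F}]$. -/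

import Mathlib

noncomputable section

open scoped NNReal

namespace LubinTateKummer

variable (p : ℕ) [Fact p.Prime]

/-! ### Valuation rings and residue fields of subfields of the algebraic closure of `ℚ_[p]` -/

/-- The restriction to `L` of the `p`-adic valuation of `PadicAlgCl p`, for a field `L` embedded
in `PadicAlgCl p`. -/
def val (L : Type*) [Field L] [Algebra L (PadicAlgCl p)] : Valuation L ℝ≥0 :=
  (Valued.v : Valuation (PadicAlgCl p) ℝ≥0).comap (algebraMap L (PadicAlgCl p))

/-- The ring of integers `{x ∈ L | |x| ≤ 1}` of `L`. -/
abbrev IntRing (L : Type*) [Field L] [Algebra L (PadicAlgCl p)] : ValuationSubring L :=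
  (val p L).valuationSubring

/-- The residue field of `L`. -/
abbrev ResField (L : Type*) [Field L] [Algebra L (PadicAlgCl p)] : Type _ :=
  IsLocalRing.ResidueField (IntRing p L)

/-- In a tower `E ⊆ L ⊆ PadicAlgCl p` the valuation of `L` extends that of `E`; this makes
`IntRing p L` an algebra over `IntRing p E` and `ResField p L` an algebra over `ResField p E`, via the inclusion. -/
instance val_hasExtension (E L : Type*) [Field E] [Field L] [Algebra E L]
    [Algebra E (PadicAlgCl p)] [Algebra L (PadicAlgCl p)] [IsScalarTower E L (PadicAlgCl p)] :
    (val p E).HasExtension (val p L) where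
  val_isEquiv_comap := by
    have h : val p E = (val p L).comap (algebraMap E L) := by
      ext x
      simp [val, ← IsScalarTower.algebraMap_apply]
    exact h ▸ Valuation.IsEquiv.refl

/-- The maximal ideal `{x | |x| < 1}` of the ring of integers of `PadicAlgCl p`. -/
def maxIdeal : Set (PadicAlgCl p) := {x | ‖x‖ < 1}

/-! ### Lubin–Tate series -/

variable {p}
variable {k : IntermediateField ℚ_[p] (PadicAlgCl p)}

/-- The value `f(x) = ∑ aᵢ xⁱ` of a power series `f` with coefficients in the ring of integers of
`k`. The series converges for every `x` in `maxIdeal p`, since `k(x)` is complete. -/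
def evalSeries (f : PowerSeries (IntRing p k)) (x : PadicAlgCl p) : PadicAlgCl p :=
  ∑' i : ℕ, algebraMap k (PadicAlgCl p) (PowerSeries.coeff i f : IntRing p k) * x ^ i

/-- `φ` is a Lubin–Tate series for `π`: `φ(X) ≡ X ^ q mod π` and `φ(X) ≡ π X mod X ^ 2`, where `q`
is the cardinality of the residue field of `k`. -/
def IsLubinTateSeries (π : IntRing p k) (φ : PowerSeries (IntRing p k)) : Prop :=
  PowerSeries.C π ∣ φ - PowerSeries.X ^ Nat.card (ResField p k) ∧
    PowerSeries.X ^ 2 ∣ φ - PowerSeries.C π * PowerSeries.X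

/-- `g` is the endomorphism `[a]_φ` of the Lubin–Tate formal module of `φ`, that is, the unique
power series over the ring of integers of `k` with `g(X) ≡ a X mod X ^ 2` and `φ ∘ g = g ∘ φ`. -/
def IsFormalMul (φ : PowerSeries (IntRing p k)) (a : IntRing p k) (g : PowerSeries (IntRing p k)) : Prop :=
  PowerSeries.X ^ 2 ∣ g - PowerSeries.C a * PowerSeries.X ∧
    PowerSeries.subst g φ = PowerSeries.subst φ g

/-- The `π ^ n`-torsion points of the Lubin–Tate formal module of `φ` (recall `[π]_φ = φ`). -/
def torsion (φ : PowerSeries (IntRing p k)) (n : ℕ) : Set (PadicAlgCl p) :=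
  {x | x ∈ maxIdeal p ∧ (evalSeries φ)^[n] x = 0}

/-- The Tate module `T_π`, the inverse limit of the sets of `π ^ n`-torsion points along the maps
`[π]_φ = φ`. -/
def tateModule (φ : PowerSeries (IntRing p k)) : Set (ℕ → PadicAlgCl p) :=
  {t | ∀ n, t n ∈ torsion φ n ∧ evalSeries φ (t (n + 1)) = t n}

/-- `χ_π(σ) = u`, where `χ_π` is the Lubin–Tate character of the absolute Galois group of `k`:
`σ` acts on the Tate module (which is free of rank one over the ring of integers of `k`)
as multiplication by `u`, that is, through `[u]_φ` on every torsion point. -/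
def LubinTateCharEq (φ : PowerSeries (IntRing p k)) (σ : PadicAlgCl p ≃ₐ[k] PadicAlgCl p)
    (u : (IntRing p k)ˣ) : Prop :=
  ∃ g : PowerSeries (IntRing p k), IsFormalMul φ u g ∧
    ∀ t ∈ tateModule φ, ∀ n, σ (t n) = evalSeries g (t n)

/-- The image `χ_π(G_K)` of the absolute Galois group of `K`, a subgroup of that of `k`. -/
def lubinTateCharImage (φ : PowerSeries (IntRing p k)) (K : IntermediateField k (PadicAlgCl p)) :
    Set (IntRing p k)ˣ :=
  {u | ∃ σ ∈ K.fixingSubgroup, LubinTateCharEq φ σ u}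

/-! ### The fields `k_π`, `K k_π` and `K̃` -/

/-- The Lubin–Tate extension `k_π / k`, generated by all the torsion points. -/
def lubinTateExt (φ : PowerSeries (IntRing p k)) : IntermediateField k (PadicAlgCl p) :=
  IntermediateField.adjoin k (⋃ n, torsion φ n)

/-- The composite `K k_π`, as an extension of `K`. -/
def compositeLT (φ : PowerSeries (IntRing p k)) (K : IntermediateField k (PadicAlgCl p)) :
    IntermediateField K (PadicAlgCl p) :=
  IntermediateField.adjoin K (lubinTateExt φ : Set (PadicAlgCl p))

/-- The field `K̃`, obtained by adjoining to `K` all `x` in the maximal ideal such that some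
iterate `φ ^ n (x)` with `n ≥ 1` lies in `K`. -/
def kummerExt (φ : PowerSeries (IntRing p k)) (K : IntermediateField k (PadicAlgCl p)) :
    IntermediateField K (PadicAlgCl p) :=
  IntermediateField.adjoin K {x | x ∈ maxIdeal p ∧ ∃ n : ℕ, 1 ≤ n ∧ (evalSeries φ)^[n] x ∈ K}

end LubinTateKummer

end

/-!
The Lubin–Tate lemma (`exists_isFormalHom`, `IsFormalHom.unique`) provides, for two Lubin–Tate
series belonging to the same uniformizer `π`, unique formal homomorphisms with prescribed linear
part. Evaluated at the elements of
absolute value less than one they turn this set into a module over the ring of integers of `k`, on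
which `π` acts through `φ` and with which the Galois action commutes (`LubinTateDatum.Point`), and
they identify the modules, hence the fields, attached to the various choices of `φ`. It is therefore
enough to treat `φ = X ^ q + π X`. There the Eisenstein polynomials `torsionPoly` show that `k_π` is
totally ramified over `k` (`IsTower.frobeniusFixed_lubinTateExt`), and that every unit of the ring
of integers of `k` is a value of the Lubin–Tate character
(`IsTower.exists_lubinTateCharEq`, by compactness of the Galois group).

Since `K` has finite degree over `k`, the residue field `𝔽_π` of `K k_π` is finite. Also `G_K` has
finite index `M` in `G_k`, so `χ_π(G_K)` contains the `M!`-th powers of the units of `ℤ_p`, and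
`1 + p ^ t` is such a power for large `t`, by Hensel's lemma (`exists_one_add_p_pow_mem`).

Choose `σ ∈ G_K` with `χ_π(σ) = 1 + p ^ c`. If `h` fixes `K k_π`, the Kummer cocycle of `h` at a
point `x` with `φ ^ n (x) ∈ K` is a torsion point, on which `σ` acts as multiplication by
`1 + p ^ c`; hence `σ h σ⁻¹ = h ^ (1 + p ^ c)` on `K̃` (`conj_apply_eq_pow_apply`). On residues all
automorphisms commute (`norm_algEquiv_comm_lt_one`), so `h ^ (p ^ c)` acts trivially on the residue
field of `K̃`. Every power residue `b ^ Q`, with `Q` the cardinality of `𝔽_π`, is the residue of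
`h b` for some such `h` (`exists_algEquiv_pow_natCard_congr`). Therefore the `p ^ c`-th power of
the Frobenius map of `𝔽_π` is trivial on the residue field of `K̃` (`frobeniusFixed_kummerExt`),
which is thus finite, of degree dividing `p ^ c` over `𝔽_π`.
-/

noncomputable section

open scoped NNReal

namespace LubinTateKummer

/-! ### Formal homomorphisms between Lubin–Tate series -/

section Formal

open MvPowerSeries Finsupp

variable {A : Type*} [CommRing A] {σ τ : Type*}

lemma exists_single_of_degree_eq_one {n : σ →₀ ℕ} (hn : degree n = 1) :
    ∃ i, n = single i 1 := by
  obtain ⟨i, hi⟩ := (Finsupp.sum_eq_one_iff n).mp hn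
  exact ⟨i, hi⟩

lemma coeff_eq_zero_of_le_order {F : MvPowerSeries σ A} {N : ℕ} (hF : (N : ℕ∞) ≤ F.order)
    {n : σ →₀ ℕ} (hn : degree n < N) : coeff n F = 0 :=
  coeff_of_lt_order (lt_of_lt_of_le (by exact_mod_cast hn) hF)

lemma one_le_order_of_constantCoeff {F : MvPowerSeries σ A} (hF : constantCoeff F = 0) :
    (1 : ℕ∞) ≤ F.order :=
  Order.one_le_iff_ne_zero.mpr (order_ne_zero_iff_constCoeff_eq_zero.mpr hF)

lemma le_order_pow_of_constantCoeff {F : MvPowerSeries σ A} (hF : constantCoeff F = 0) (j : ℕ) :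
    (j : ℕ∞) ≤ (F ^ j).order := by
  refine le_trans ?_ (le_order_pow j)
  rw [nsmul_eq_mul]
  exact le_mul_of_one_le_right' (one_le_order_of_constantCoeff hF)

lemma coeff_subst_eq_sum (φ : PowerSeries A) {F : MvPowerSeries σ A} (hF : constantCoeff F = 0)
    (n : σ →₀ ℕ) :
    coeff n (φ.subst F) =
      ∑ j ∈ Finset.range (degree n + 1), PowerSeries.coeff j φ * coeff n (F ^ j) := by
  rw [PowerSeries.coeff_subst (PowerSeries.HasSubst.of_constantCoeff_zero hF)]
  simp only [smul_eq_mul]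
  apply finsum_eq_sum_of_support_subset
  intro j hj
  simp only [Function.mem_support] at hj
  by_contra hjn
  simp only [Finset.coe_range, Set.mem_Iio, not_lt] at hjn
  apply hj
  rw [coeff_eq_zero_of_le_order (le_order_pow_of_constantCoeff hF j) (by omega), mul_zero]

/-- Composing with `φ` on the left is, to lowest order, multiplication by the linear coefficient
of `φ`. -/
lemma coeff_subst_sub_subst (φ : PowerSeries A) {F G : MvPowerSeries σ A}
    (hF : constantCoeff F = 0) (hG : constantCoeff G = 0) {N : ℕ}
    (h : (N : ℕ∞) ≤ (F - G).order) {n : σ →₀ ℕ} (hn : degree n ≤ N) :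
    coeff n (φ.subst F) - coeff n (φ.subst G) = PowerSeries.coeff 1 φ * coeff n (F - G) := by
  rw [coeff_subst_eq_sum φ hF, coeff_subst_eq_sum φ hG, ← Finset.sum_sub_distrib]
  have key : ∀ j, j ≠ 1 →
      PowerSeries.coeff j φ * coeff n (F ^ j) - PowerSeries.coeff j φ * coeff n (G ^ j) = 0 := by
    intro j hj
    rw [← mul_sub, ← map_sub]
    rcases Nat.lt_or_gt_of_ne hj with hj | hj
    · simp [Nat.lt_one_iff.mp hj]
    · rw [← geom_sum₂_mul]
      have h1 : ((N + 1 : ℕ) : ℕ∞) ≤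
          ((∑ i ∈ Finset.range j, F ^ i * G ^ (j - 1 - i)) * (F - G)).order := by
        refine le_trans ?_ le_order_mul
        rw [Nat.cast_add, add_comm]
        refine add_le_add ?_ h
        rw [Nat.cast_one]
        apply one_le_order_of_constantCoeff
        rw [map_sum]
        refine Finset.sum_eq_zero fun i hi => ?_
        have : i ≠ 0 ∨ j - 1 - i ≠ 0 := by omega
        rcases this with h0 | h0 <;> simp [hF, hG, h0]
      rw [coeff_eq_zero_of_le_order h1 (by omega), mul_zero]
  by_cases hd : degree n = 0
  · rw [hd]
    have h0 : n = 0 := (degree_eq_zero_iff n).mp hd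
    subst h0
    simp [hF, hG]
  · rw [Finset.sum_eq_single 1 (fun j _ hj => key j hj)
      (fun h1 => absurd (Finset.mem_range.mpr (by omega)) h1)]
    simp [mul_sub]

variable [Finite σ]

/-- The family `(ψ(X_i))_i`, to be substituted in a power series in the variables `X_i`. -/
def diagSubst (σ : Type*) (ψ : PowerSeries A) : σ → MvPowerSeries σ A :=
  fun i => ψ.subst (X i : MvPowerSeries σ A)

omit [Finite σ] in
lemma constantCoeff_powerSeries_subst {φ : PowerSeries A} (hφ : PowerSeries.constantCoeff φ = 0)
    {F : MvPowerSeries σ A} (hF : constantCoeff F = 0) : constantCoeff (φ.subst F) = 0 :=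
  PowerSeries.constantCoeff_subst_eq_zero hF _ hφ

omit [Finite σ] in
lemma constantCoeff_diagSubst {ψ : PowerSeries A} (hψ : PowerSeries.constantCoeff ψ = 0) (i : σ) :
    constantCoeff (diagSubst σ ψ i) = 0 :=
  constantCoeff_powerSeries_subst hψ (by simp)

lemma hasSubst_diagSubst {ψ : PowerSeries A} (hψ : PowerSeries.constantCoeff ψ = 0) :
    HasSubst (diagSubst σ ψ) :=
  hasSubst_of_constantCoeff_zero (constantCoeff_diagSubst hψ)

omit [Finite σ] in
lemma exists_diagSubst_eq_X_mul {ψ : PowerSeries A} (hψ : PowerSeries.constantCoeff ψ = 0)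
    (i : σ) : ∃ W : MvPowerSeries σ A,
      diagSubst σ ψ i = X i * W ∧ constantCoeff W = PowerSeries.coeff 1 ψ := by
  obtain ⟨ω, rfl⟩ := PowerSeries.X_dvd_iff.mpr hψ
  have hX : PowerSeries.HasSubst (X i : MvPowerSeries σ A) := PowerSeries.HasSubst.X i
  refine ⟨ω.subst (X i : MvPowerSeries σ A), ?_, ?_⟩
  · rw [diagSubst, PowerSeries.subst_mul hX, PowerSeries.subst_X hX]
  · rw [← coeff_zero_eq_constantCoeff_apply, coeff_subst_eq_sum ω (by simp)]
    simp [PowerSeries.coeff_succ_X_mul 0 ω]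

omit [Finite σ] in
/-- The monomial `X ^ d` becomes `c ^ |d| X ^ d` plus terms of higher degree when `ψ(X_i)` is
substituted for `X_i`, where `c` is the linear coefficient of `ψ`. -/
lemma coeff_prod_diagSubst {ψ : PowerSeries A} (hψ : PowerSeries.constantCoeff ψ = 0)
    {d n : σ →₀ ℕ} (h : degree n ≤ degree d) [Decidable (d = n)] :
    coeff n (d.prod fun s e => diagSubst σ ψ s ^ e) =
      if d = n then PowerSeries.coeff 1 ψ ^ degree n else 0 := by
  classical
  choose W hW hW0 using fun i : σ => exists_diagSubst_eq_X_mul hψ i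
  have : (d.prod fun s e => diagSubst σ ψ s ^ e) =
      monomial d 1 * d.prod fun s e => W s ^ e := by
    rw [monomial_one_eq, ← Finsupp.prod_mul]
    simp only [hW, mul_pow]
  rw [this, coeff_monomial_mul]
  split_ifs with h1 h2 h2
  · subst h2
    rw [tsub_self, one_mul, coeff_zero_eq_constantCoeff_apply, Finsupp.prod, map_prod]
    simp only [map_pow, hW0]
    rw [Finset.prod_pow_eq_pow_sum]
    rfl
  · exfalso
    apply h2
    obtain ⟨e, rfl⟩ := exists_add_of_le h1
    rw [map_add] at h
    have : degree e = 0 := by omega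
    rw [(degree_eq_zero_iff e).mp this, add_zero]
  · exact absurd h2.le h1
  · rfl

/-- Composing with `ψ` on the right multiplies the part of lowest degree `N` by the `N`-th power
of the linear coefficient of `ψ`. -/
lemma coeff_subst_diagSubst {ψ : PowerSeries A} (hψ : PowerSeries.constantCoeff ψ = 0)
    {H : MvPowerSeries σ A} {N : ℕ} (h : (N : ℕ∞) ≤ H.order) {n : σ →₀ ℕ} (hn : degree n ≤ N) :
    coeff n (H.subst (diagSubst σ ψ)) = PowerSeries.coeff 1 ψ ^ degree n * coeff n H := by
  classical
  rw [coeff_subst (hasSubst_diagSubst hψ)]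
  rw [finsum_eq_single _ n]
  · rw [coeff_prod_diagSubst hψ le_rfl, if_pos rfl, smul_eq_mul, mul_comm]
  · intro d hd
    by_cases hdN : degree d < N
    · rw [coeff_eq_zero_of_le_order h hdN, zero_smul]
    · rw [coeff_prod_diagSubst hψ (by omega), if_neg hd, smul_zero]

/-- The defect of `F` as a homomorphism from `ψ` to `φ`. -/
def homDefect (φ ψ : PowerSeries A) (F : MvPowerSeries σ A) : MvPowerSeries σ A :=
  φ.subst F - F.subst (diagSubst σ ψ)

/-- `F` is a homomorphism from `ψ` to `φ`, that is `φ ∘ F = F ∘ ψ`, with linear part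
`∑ aᵢ Xᵢ` and without constant term. -/
structure IsFormalHom (φ ψ : PowerSeries A) (a : σ → A) (F : MvPowerSeries σ A) : Prop where
  constantCoeff_eq : constantCoeff F = 0
  coeff_single : ∀ i, coeff (single i 1) F = a i
  comm : φ.subst F = F.subst (diagSubst σ ψ)

/-- The properties of a uniformizer `π` of a local field with residue field of cardinality `q`
on which the Lubin–Tate construction rests. -/
structure IsLubinTateBase (π : A) (q : ℕ) : Prop where
  ne_zero : π ≠ 0
  isUnit_one_sub : ∀ n ≠ 0, IsUnit (1 - π ^ n)
  not_isUnit : ¬ IsUnit π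
  exists_prime : ∃ p : ℕ, p.Prime ∧ π ∣ (p : A) ∧ ∃ f ≠ 0, q = p ^ f
  dvd_pow_sub : ∀ a : A, π ∣ a ^ q - a

/-- `φ` is congruent to `X ^ q` modulo `π` and to `π X` modulo `X ^ 2`. -/
structure IsFrobeniusLift (π : A) (q : ℕ) (φ : PowerSeries A) : Prop where
  C_dvd : PowerSeries.C π ∣ φ - PowerSeries.X ^ q
  constantCoeff_eq : PowerSeries.constantCoeff φ = 0
  coeff_one : PowerSeries.coeff 1 φ = π

/-- Changing `F` in degree `N` changes the part of degree `N` of the defect by the factor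
`π - π ^ N`. -/
lemma coeff_homDefect_sub {π : A} {φ ψ : PowerSeries A} (hφ : PowerSeries.coeff 1 φ = π)
    (hψ : PowerSeries.coeff 1 ψ = π) (hψ0 : PowerSeries.constantCoeff ψ = 0)
    {F G : MvPowerSeries σ A}
    (hF : constantCoeff F = 0) (hG : constantCoeff G = 0) {N : ℕ}
    (h : (N : ℕ∞) ≤ (F - G).order) {n : σ →₀ ℕ} (hn : degree n ≤ N) :
    coeff n (homDefect φ ψ F) - coeff n (homDefect φ ψ G) =
      (π - π ^ degree n) * coeff n (F - G) := by
  have h1 := coeff_subst_sub_subst φ hF hG h hn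
  have h2 := coeff_subst_diagSubst hψ0 h hn
  rw [subst_sub (hasSubst_diagSubst hψ0), map_sub, hψ] at h2
  rw [hφ] at h1
  simp only [homDefect, map_sub] at h1 h2 ⊢
  linear_combination h1 - h2

/-- Modulo `π` both sides of `φ ∘ F = F ∘ ψ` are the `q`-th power of `F`. -/
lemma dvd_coeff_homDefect {π : A} {q : ℕ} (hA : IsLubinTateBase π q) {φ ψ : PowerSeries A}
    (hφ : IsFrobeniusLift π q φ) (hψ : IsFrobeniusLift π q ψ) {F : MvPowerSeries σ A}
    (hF : constantCoeff F = 0) (n : σ →₀ ℕ) : π ∣ coeff n (homDefect φ ψ F) := by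
  obtain ⟨p, hp, hpπ, f, hf, rfl⟩ := hA.exists_prime
  set r := Ideal.Quotient.mk (Ideal.span {π}) with hr
  have hrπ : r π = 0 := (Ideal.Quotient.eq_zero_iff_dvd π π).mpr dvd_rfl
  have hnt : Nontrivial (A ⧸ Ideal.span {π}) :=
    Ideal.Quotient.nontrivial_iff.mpr fun h => hA.not_isUnit (Ideal.span_singleton_eq_top.mp h)
  have hchar : CharP (A ⧸ Ideal.span {π}) p := by
    rw [CharP.charP_iff_prime_eq_zero hp]
    have := (Ideal.Quotient.eq_zero_iff_dvd π (p : A)).mpr hpπ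
    rwa [map_natCast] at this
  have : Fact p.Prime := ⟨hp⟩
  have hfrob : iterateFrobenius (A ⧸ Ideal.span {π}) p f = RingHom.id _ := by
    refine RingHom.ext fun x => ?_
    obtain ⟨a, rfl⟩ := Ideal.Quotient.mk_surjective x
    have := (Ideal.Quotient.eq_zero_iff_dvd π (a ^ p ^ f - a)).mpr (hA.dvd_pow_sub a)
    rw [map_sub, map_pow, sub_eq_zero] at this
    simpa [iterateFrobenius_def] using this
  have hmap : ∀ {χ : PowerSeries A}, IsFrobeniusLift π (p ^ f) χ →
      PowerSeries.map r χ = PowerSeries.X ^ p ^ f := by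
    intro χ hχ
    obtain ⟨ω, hω⟩ := hχ.C_dvd
    have := congrArg (PowerSeries.map r) hω
    rw [map_sub, map_mul, PowerSeries.map_C, hrπ, map_zero, zero_mul, sub_eq_zero] at this
    simpa using this
  have hq : p ^ f ≠ 0 := pow_ne_zero _ hp.ne_zero
  have hFs : PowerSeries.HasSubst F := PowerSeries.HasSubst.of_constantCoeff_zero hF
  have hFs' : PowerSeries.HasSubst (MvPowerSeries.map r F) :=
    PowerSeries.HasSubst.of_constantCoeff_zero (by simp [hF])
  rw [← Ideal.Quotient.eq_zero_iff_dvd, ← hr, ← coeff_map, homDefect, map_sub,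
    PowerSeries.map_subst hFs, MvPowerSeries.map_subst (hasSubst_diagSubst hψ.constantCoeff_eq),
    hmap hφ, PowerSeries.subst_pow hFs', PowerSeries.subst_X hFs']
  have hd : (fun i => MvPowerSeries.map r (diagSubst σ ψ i)) =
      fun i => (X i : MvPowerSeries σ (A ⧸ Ideal.span {π})) ^ p ^ f := by
    funext i
    rw [diagSubst, PowerSeries.map_subst (PowerSeries.HasSubst.X i), hmap hψ, map_X,
      PowerSeries.subst_pow (PowerSeries.HasSubst.X i),
      PowerSeries.subst_X (PowerSeries.HasSubst.X i)]
  have he : MvPowerSeries.subst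
      (fun i => (X i : MvPowerSeries σ (A ⧸ Ideal.span {π})) ^ p ^ f) (MvPowerSeries.map r F) =
      expand (p ^ f) hq (MvPowerSeries.map r F) := by
    rw [expand, coe_substAlgHom]
  rw [hd, he, ← map_iterateFrobenius_expand p hp.ne_zero, hfrob]
  simp

variable [IsDomain A]

lemma pi_sub_pow_ne_zero {π : A} {q : ℕ} (hA : IsLubinTateBase π q) {N : ℕ} (hN : 2 ≤ N) :
    π - π ^ N ≠ 0 := by
  obtain ⟨M, rfl⟩ : ∃ M, N = M + 1 := ⟨N - 1, by omega⟩
  rw [show π - π ^ (M + 1) = π * (1 - π ^ M) by ring]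
  exact mul_ne_zero hA.ne_zero (hA.isUnit_one_sub M (by omega)).ne_zero

omit [IsDomain A] in
lemma pi_sub_pow_dvd {π : A} {q : ℕ} (hA : IsLubinTateBase π q) {N : ℕ} (hN : 2 ≤ N) {c : A}
    (hc : π ∣ c) : π - π ^ N ∣ c := by
  obtain ⟨M, rfl⟩ : ∃ M, N = M + 1 := ⟨N - 1, by omega⟩
  rw [show π - π ^ (M + 1) = π * (1 - π ^ M) by ring]
  exact (hA.isUnit_one_sub M (by omega)).mul_right_dvd.mpr hc

/-- Two series with the same linear part that commute with `φ`, `ψ` below degree `N` agree below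
degree `N`. -/
lemma le_order_sub_of_homDefect {π : A} {q : ℕ} (hA : IsLubinTateBase π q) {φ ψ : PowerSeries A}
    (hφ : IsFrobeniusLift π q φ) (hψ : IsFrobeniusLift π q ψ) {F G : MvPowerSeries σ A}
    (hF : constantCoeff F = 0) (hG : constantCoeff G = 0)
    (hlin : ∀ i, coeff (single i 1) F = coeff (single i 1) G) {N : ℕ}
    (hFN : (N : ℕ∞) ≤ (homDefect φ ψ F).order) (hGN : (N : ℕ∞) ≤ (homDefect φ ψ G).order) :
    (N : ℕ∞) ≤ (F - G).order := by
  have key : ∀ j ≤ N, (j : ℕ∞) ≤ (F - G).order := by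
    intro j
    induction j with
    | zero => simp
    | succ j ih =>
      intro hj
      have ih := ih (by omega)
      refine nat_le_order fun n hn => ?_
      rcases Nat.lt_succ_iff_lt_or_eq.mp hn with hn | hn
      · exact coeff_eq_zero_of_le_order ih hn
      have h1 := coeff_homDefect_sub hφ.coeff_one hψ.coeff_one hψ.constantCoeff_eq hF hG ih hn.le
      rw [coeff_eq_zero_of_le_order hFN (by omega), coeff_eq_zero_of_le_order hGN (by omega),
        sub_zero, eq_comm, mul_eq_zero] at h1
      rcases h1 with h1 | h1
      · have : ¬ 2 ≤ degree n := fun h2 => pi_sub_pow_ne_zero hA h2 h1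
        rcases (by omega : degree n = 0 ∨ degree n = 1) with h0 | h0
        · rw [(degree_eq_zero_iff n).mp h0]
          simp [hF, hG]
        · obtain ⟨i, rfl⟩ := exists_single_of_degree_eq_one h0
          rw [map_sub, hlin, sub_self]
      · exact h1
  exact key N le_rfl

/-- Uniqueness in the Lubin–Tate lemma. -/
lemma IsFormalHom.unique {π : A} {q : ℕ} (hA : IsLubinTateBase π q) {φ ψ : PowerSeries A}
    (hφ : IsFrobeniusLift π q φ) (hψ : IsFrobeniusLift π q ψ) {a : σ → A}
    {F G : MvPowerSeries σ A} (hF : IsFormalHom φ ψ a F) (hG : IsFormalHom φ ψ a G) : F = G := by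
  have hdef : ∀ {H : MvPowerSeries σ A}, IsFormalHom φ ψ a H → homDefect φ ψ H = 0 :=
    fun hH => sub_eq_zero.mpr hH.comm
  ext n
  have := le_order_sub_of_homDefect hA hφ hψ hF.constantCoeff_eq hG.constantCoeff_eq
    (fun i => by rw [hF.coeff_single, hG.coeff_single]) (N := degree n + 1)
    (by simp [hdef hF]) (by simp [hdef hG])
  have := coeff_eq_zero_of_le_order this (Nat.lt_succ_self _)
  rwa [map_sub, sub_eq_zero] at this

omit [IsDomain A] in
/-- Successive approximation in the Lubin–Tate lemma: the terms of degree `N` can be chosen so as to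
cancel the defect in this degree, since the defect is divisible by `π`, hence by `π - π ^ N`. -/
lemma exists_le_order_homDefect {π : A} {q : ℕ} (hA : IsLubinTateBase π q) {φ ψ : PowerSeries A}
    (hφ : IsFrobeniusLift π q φ) (hψ : IsFrobeniusLift π q ψ) (a : σ → A) (N : ℕ) :
    ∃ F : MvPowerSeries σ A, constantCoeff F = 0 ∧ (∀ i, coeff (single i 1) F = a i) ∧
      ((N + 2 : ℕ) : ℕ∞) ≤ (homDefect φ ψ F).order := by
  classical
  induction N with
  | zero =>
    cases nonempty_fintype σ
    set F : MvPowerSeries σ A := ∑ i, monomial (single i 1) (a i) with hFdef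
    have hF : constantCoeff F = 0 := by
      rw [← coeff_zero_eq_constantCoeff_apply, hFdef, map_sum]
      refine Finset.sum_eq_zero fun i _ => ?_
      rw [coeff_monomial, if_neg]
      intro h
      have := DFunLike.congr_fun h i
      simp at this
    refine ⟨F, hF, fun i => ?_, nat_le_order fun n hn => ?_⟩
    · rw [hFdef, map_sum, Finset.sum_eq_single i]
      · rw [coeff_monomial, if_pos rfl]
      · intro j _ hj
        rw [coeff_monomial, if_neg]
        intro h
        have := DFunLike.congr_fun h i
        simp [hj] at this
      · simp
    · have h1 : ((1 : ℕ) : ℕ∞) ≤ (F - 0).order := by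
        rw [sub_zero]
        exact_mod_cast one_le_order_of_constantCoeff hF
      have h2 := coeff_homDefect_sub (n := n) hφ.coeff_one hψ.coeff_one hψ.constantCoeff_eq hF
        (map_zero constantCoeff) h1 (by omega)
      have h3 : homDefect φ ψ (0 : MvPowerSeries σ A) = 0 := by
        rw [homDefect, ← coe_substAlgHom (hasSubst_diagSubst hψ.constantCoeff_eq), map_zero,
          PowerSeries.subst_zero_of_constantCoeff_zero hφ.constantCoeff_eq, sub_zero]
      rw [h3, map_zero, sub_zero, sub_zero] at h2
      rw [h2]
      rcases (by omega : degree n = 0 ∨ degree n = 1) with h0 | h0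
      · rw [(degree_eq_zero_iff n).mp h0, coeff_zero_eq_constantCoeff_apply, hF, mul_zero]
      · rw [h0, pow_one, sub_self, zero_mul]
  | succ N ih =>
    obtain ⟨F, hF0, hF1, hF⟩ := ih
    choose c hc using fun n : σ →₀ ℕ => pi_sub_pow_dvd hA (N := N + 2) (by omega)
      (dvd_coeff_homDefect hA hφ hψ hF0 n)
    -- By `coeff_homDefect_sub`, adding `G` changes the defect in degree `N + 2` by
    -- `(π - π ^ (N + 2)) G`, so that `G = -c` cancels it.
    set G : MvPowerSeries σ A := fun n => if degree n = N + 2 then - c n else 0 with hGdef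
    have hG : ∀ n, coeff n G = if degree n = N + 2 then - c n else 0 := fun n => rfl
    have hG0 : constantCoeff G = 0 := by
      rw [← coeff_zero_eq_constantCoeff_apply, hG, if_neg (by simp)]
    refine ⟨F + G, by simp [hF0, hG0], fun i => ?_, nat_le_order fun n hn => ?_⟩
    · rw [map_add, hF1, hG, if_neg (by simp), add_zero]
    · have h1 : ((N + 2 : ℕ) : ℕ∞) ≤ (F + G - F).order := by
        refine nat_le_order fun n hn => ?_
        rw [add_sub_cancel_left, hG, if_neg (by omega)]
      have h2 := coeff_homDefect_sub (n := n) hφ.coeff_one hψ.coeff_one hψ.constantCoeff_eq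
        (by simp [hF0, hG0]) hF0 h1 (by omega)
      rw [add_sub_cancel_left, hG] at h2
      rcases (by omega : degree n < N + 2 ∨ degree n = N + 2) with h0 | h0
      · rw [coeff_eq_zero_of_le_order hF h0, if_neg (by omega), mul_zero, sub_zero] at h2
        exact h2
      · rw [if_pos h0, hc n, h0] at h2
        linear_combination h2

/-- Existence in the Lubin–Tate lemma. -/
lemma exists_isFormalHom {π : A} {q : ℕ} (hA : IsLubinTateBase π q) {φ ψ : PowerSeries A}
    (hφ : IsFrobeniusLift π q φ) (hψ : IsFrobeniusLift π q ψ) (a : σ → A) :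
    ∃ F : MvPowerSeries σ A, IsFormalHom φ ψ a F := by
  choose f hf0 hf1 hf using exists_le_order_homDefect hA hφ hψ a
  have hmono : ∀ {N M}, N ≤ M → ((N + 2 : ℕ) : ℕ∞) ≤ (f M - f N).order := by
    intro N M hNM
    refine le_order_sub_of_homDefect hA hφ hψ (hf0 M) (hf0 N) (fun i => by rw [hf1, hf1])
      (le_trans ?_ (hf M)) (hf N)
    exact_mod_cast (by omega : N + 2 ≤ M + 2)
  set F : MvPowerSeries σ A := fun n => coeff n (f (degree n)) with hFdef
  have hF : ∀ n, coeff n F = coeff n (f (degree n)) := fun n => rfl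
  have hFf : ∀ N, ((N + 1 : ℕ) : ℕ∞) ≤ (F - f N).order := by
    refine fun N => nat_le_order fun n hn => ?_
    have := coeff_eq_zero_of_le_order (hmono (show degree n ≤ N by omega)) (n := n) (by omega)
    rw [map_sub] at this ⊢
    rw [hF, ← neg_sub, this, neg_zero]
  have hF0 : constantCoeff F = 0 := by
    rw [← coeff_zero_eq_constantCoeff_apply, hF, coeff_zero_eq_constantCoeff_apply, hf0]
  refine ⟨F, hF0, fun i => by rw [hF, hf1], sub_eq_zero.mp ?_⟩
  change homDefect φ ψ F = 0
  ext n
  have h2 := coeff_homDefect_sub (n := n) hφ.coeff_one hψ.coeff_one hψ.constantCoeff_eq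
    hF0 (hf0 (degree n)) (hFf (degree n)) (by omega)
  have h3 := coeff_eq_zero_of_le_order (hFf (degree n)) (n := n) (by omega)
  have h4 := coeff_eq_zero_of_le_order (hf (degree n)) (n := n) (by omega)
  rw [h3, mul_zero, h4, sub_zero] at h2
  rw [h2, map_zero]

omit [IsDomain A] [Finite σ] in
/-- The linear part of a composite is the composite of the linear parts. -/
lemma coeff_single_subst [Fintype τ] {F : MvPowerSeries τ A}
    (hF : constantCoeff F = 0) {G : τ → MvPowerSeries σ A} (hG : ∀ i, constantCoeff (G i) = 0)
    (s : σ) : coeff (single s 1) (F.subst G) =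
      ∑ i, coeff (single i 1) F * coeff (single s 1) (G i) := by
  classical
  rw [coeff_subst (hasSubst_of_constantCoeff_zero hG)]
  have hinj : Function.Injective fun i : τ => (single i 1 : τ →₀ ℕ) :=
    Finsupp.single_left_injective one_ne_zero
  rw [finsum_eq_sum_of_support_subset (s := Finset.univ.map ⟨_, hinj⟩)]
  · refine (Finset.sum_map _ _ _).trans (Finset.sum_congr rfl fun i _ => ?_)
    simp [Finsupp.prod_single_index]
  · intro d hd
    simp only [Function.mem_support, smul_eq_mul] at hd
    simp only [Finset.coe_map, Function.Embedding.coeFn_mk, Finset.coe_univ, Set.image_univ,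
      Set.mem_range]
    by_contra hcon
    apply hd
    rcases Nat.lt_or_ge (degree d) 2 with h2 | h2
    · rcases (by omega : degree d = 0 ∨ degree d = 1) with h0 | h0
      · rw [(degree_eq_zero_iff d).mp h0, coeff_zero_eq_constantCoeff_apply, hF, zero_mul]
      · obtain ⟨i, rfl⟩ := exists_single_of_degree_eq_one h0
        exact absurd ⟨i, rfl⟩ hcon
    · have : ((2 : ℕ) : ℕ∞) ≤ (d.prod fun s e => G s ^ e).order := by
        rw [Finsupp.prod]
        refine le_trans ?_ (le_order_prod _ _)
        calc ((2 : ℕ) : ℕ∞) ≤ ((degree d : ℕ) : ℕ∞) := by exact_mod_cast h2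
          _ = ∑ i ∈ d.support, (d i : ℕ∞) := by rw [degree_apply, Nat.cast_sum]
          _ ≤ _ := Finset.sum_le_sum fun i _ => le_order_pow_of_constantCoeff (hG i) _
      rw [coeff_eq_zero_of_le_order this (by simp), mul_zero]

omit [IsDomain A] in
/-- Homomorphisms of Lubin–Tate series compose, with composition of the linear parts. -/
lemma IsFormalHom.comp [Fintype τ] {φ ψ χ : PowerSeries A}
    (hψ : PowerSeries.constantCoeff ψ = 0) (hχ : PowerSeries.constantCoeff χ = 0)
    {b : τ → A} {F : MvPowerSeries τ A} (hF : IsFormalHom φ ψ b F) {a : τ → σ → A}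
    {G : τ → MvPowerSeries σ A} (hG : ∀ i, IsFormalHom ψ χ (a i) (G i)) :
    IsFormalHom φ χ (fun s => ∑ i, b i * a i s) (F.subst G) := by
  have hG0 : ∀ i, constantCoeff (G i) = 0 := fun i => (hG i).constantCoeff_eq
  have hGs : HasSubst G := hasSubst_of_constantCoeff_zero hG0
  refine ⟨constantCoeff_subst_eq_zero hGs hG0 hF.constantCoeff_eq, fun s => ?_, ?_⟩
  · rw [coeff_single_subst hF.constantCoeff_eq hG0]
    simp only [hF.coeff_single, (hG _).coeff_single]
  · have hFs : PowerSeries.HasSubst F :=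
      PowerSeries.HasSubst.of_constantCoeff_zero hF.constantCoeff_eq
    have h1 : φ.subst (F.subst G) = (φ.subst F).subst G := by
      rw [PowerSeries.subst_def, PowerSeries.subst_def, subst_comp_subst_apply hFs.const hGs]
    rw [h1, hF.comm, subst_comp_subst_apply (hasSubst_diagSubst hψ) hGs,
      subst_comp_subst_apply hGs (hasSubst_diagSubst hχ)]
    congr 1
    funext i
    rw [← (hG i).comm, diagSubst, PowerSeries.subst_def, PowerSeries.subst_def,
      subst_comp_subst_apply (PowerSeries.HasSubst.X i).const hGs]
    congr 1
    funext _
    exact subst_X hGs i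

omit [IsDomain A] in
/-- The coordinates are homomorphisms. -/
lemma isFormalHom_X [DecidableEq σ] {φ : PowerSeries A}
    (hφ : PowerSeries.constantCoeff φ = 0) (i : σ) :
    IsFormalHom φ φ (Pi.single i 1) (X i : MvPowerSeries σ A) := by
  refine ⟨by simp, fun j => ?_, ?_⟩
  · rw [coeff_X]
    by_cases h : j = i
    · subst h; simp
    · rw [if_neg, Pi.single_eq_of_ne h]
      intro h'
      exact h (Finsupp.single_left_injective one_ne_zero h')
  · rw [subst_X (hasSubst_diagSubst hφ)]
    rfl

end Formal

/-! ### Evaluation of power series on the maximal ideal -/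

section DiscreteCoefficients

open MvPowerSeries

variable {A S : Type*} [CommRing A] [CommRing S] [UniformSpace S] [IsUniformAddGroup S]
  [CompleteSpace S] [T2Space S] [IsTopologicalRing S] [IsLinearTopology S S] {σ τ : Type*}

/-- Evaluation of power series whose ring of coefficients carries the discrete topology. -/
def discreteEval (ι : A →+* S) (x : σ → S) (F : MvPowerSeries σ A) : S :=
  letI : UniformSpace A := ⊥
  eval₂ ι x F

lemma hasSum_discreteEval (ι : A →+* S) {x : σ → S} (hx : HasEval x) (F : MvPowerSeries σ A) :
    HasSum (fun d : σ →₀ ℕ => ι (coeff d F) * d.prod fun s e => x s ^ e)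
      (discreteEval ι x F) := by
  let : UniformSpace A := ⊥
  have : DiscreteUniformity A := ⟨rfl⟩
  exact hasSum_eval₂ continuous_of_discreteTopology hx F

lemma discreteEval_subst (ι : A →+* S) {x : σ → S} (hx : HasEval x)
    {G : τ → MvPowerSeries σ A} (hG : HasSubst G) (F : MvPowerSeries τ A) :
    discreteEval ι x (F.subst G) = discreteEval ι (fun i => discreteEval ι x (G i)) F := by
  let : UniformSpace A := ⊥
  have : DiscreteUniformity A := ⟨rfl⟩
  let : Algebra A S := ι.toAlgebra
  exact eval₂_subst (R := A) (S := A) (T := S) hG hx F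

end DiscreteCoefficients

section Evaluation

open MvPowerSeries Topology

variable {p : ℕ} [Fact p.Prime] {k : IntermediateField ℚ_[p] (PadicAlgCl p)}

lemma norm_le_one_of_intRing {L : Type*} [Field L] [Algebra L (PadicAlgCl p)] (a : IntRing p L) :
    ‖algebraMap L (PadicAlgCl p) a‖ ≤ 1 := by
  have h : (val p L) (a : L) ≤ 1 := a.2
  exact_mod_cast h

lemma mem_intRing_iff {L : Type*} [Field L] [Algebra L (PadicAlgCl p)] (a : L) :
    a ∈ IntRing p L ↔ ‖algebraMap L (PadicAlgCl p) a‖ ≤ 1 := by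
  refine ⟨fun h => norm_le_one_of_intRing ⟨a, h⟩, fun h => ?_⟩
  change (val p L) a ≤ 1
  exact_mod_cast h

lemma norm_algEquiv (s : PadicAlgCl p ≃ₐ[k] PadicAlgCl p) (x : PadicAlgCl p) : ‖s x‖ = ‖x‖ :=
  (spectralNorm_eq_of_equiv (s.restrictScalars ℚ_[p]) x).symm

lemma continuous_algEquiv (s : PadicAlgCl p ≃ₐ[k] PadicAlgCl p) : Continuous s :=
  (AddMonoidHomClass.isometry_of_norm (s : PadicAlgCl p →+ PadicAlgCl p)
    (norm_algEquiv s)).continuous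

/-- The elements of norm at most one of a subfield of `PadicAlgCl p`, as a subring. -/
def unitSubring (L : IntermediateField ℚ_[p] (PadicAlgCl p)) : Subring (PadicAlgCl p) where
  carrier := {x | x ∈ L ∧ ‖x‖ ≤ 1}
  zero_mem' := ⟨zero_mem L, by simp⟩
  one_mem' := ⟨one_mem L, by simp⟩
  add_mem' hx hy := ⟨add_mem hx.1 hy.1,
    (IsUltrametricDist.norm_add_le_max _ _).trans (max_le hx.2 hy.2)⟩
  mul_mem' hx hy := ⟨mul_mem hx.1 hy.1, by
    rw [norm_mul]; exact mul_le_one₀ hx.2 (norm_nonneg _) hy.2⟩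
  neg_mem' hx := ⟨neg_mem hx.1, by rw [norm_neg]; exact hx.2⟩

instance completeSpace_unitSubring (L : IntermediateField ℚ_[p] (PadicAlgCl p))
    [FiniteDimensional ℚ_[p] L] : CompleteSpace (unitSubring L) := by
  have : FiniteDimensional ℚ_[p] L.toSubmodule := ‹FiniteDimensional ℚ_[p] L›
  have h1 : IsComplete (L : Set (PadicAlgCl p)) :=
    Submodule.complete_of_finiteDimensional L.toSubmodule
  have h2 : IsClosed {x : PadicAlgCl p | ‖x‖ ≤ 1} := isClosed_le continuous_norm continuous_const
  have h3 : IsComplete ((unitSubring L : Subring (PadicAlgCl p)) : Set (PadicAlgCl p)) := by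
    intro f hf hfs
    have hsub : ∀ {t : Set (PadicAlgCl p)}, (unitSubring L : Set (PadicAlgCl p)) ⊆ t →
        f ≤ Filter.principal t := fun h => hfs.trans (Filter.principal_mono.mpr h)
    obtain ⟨x, hx, hfx⟩ := h1 f hf (hsub fun y hy => hy.1)
    have : f.NeBot := hf.1
    exact ⟨x, ⟨hx, h2.mem_of_tendsto (Filter.tendsto_id'.mpr hfx)
      (Filter.le_principal_iff.mp (hsub fun y hy => hy.2))⟩, hfx⟩
  exact completeSpace_coe_iff_isComplete.mpr h3

instance isLinearTopology_unitSubring (L : IntermediateField ℚ_[p] (PadicAlgCl p)) :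
    IsLinearTopology (unitSubring L) (unitSubring L) := by
  let I : {ε : ℝ // 0 < ε} → Ideal (unitSubring L) := fun ε =>
    { carrier := {x | ‖x‖ < ε}
      zero_mem' := by simpa using ε.2
      add_mem' := fun {x y} hx hy =>
        (IsUltrametricDist.norm_add_le_max (x : PadicAlgCl p) y).trans_lt (max_lt hx hy)
      smul_mem' := fun c x hx => by
        change ‖(c : PadicAlgCl p) * x‖ < ε
        rw [norm_mul]
        exact (mul_le_of_le_one_left (norm_nonneg _) c.2.2).trans_lt hx }
  refine IsLinearTopology.mk_of_hasBasis (unitSubring L) (ι := {ε : ℝ // 0 < ε})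
    (p := fun _ => True) (s := I) ?_
  have := Metric.nhds_basis_ball (x := (0 : unitSubring L))
  refine ⟨fun t => ?_⟩
  rw [this.mem_iff]
  constructor
  · rintro ⟨ε, hε, ht⟩
    exact ⟨⟨ε, hε⟩, trivial, fun x hx => ht (by
      have : ‖x‖ < ε := hx
      simpa using this)⟩
  · rintro ⟨ε, -, ht⟩
    exact ⟨ε, ε.2, fun x hx => ht (by
      have : ‖x‖ < ε := by simpa using hx
      exact this)⟩

/-- The inclusion of the ring of integers of `k` in the ring of integers of a larger field. -/
def intRingToUnitSubring {L : IntermediateField ℚ_[p] (PadicAlgCl p)} (hL : k ≤ L) :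
    IntRing p k →+* unitSubring L :=
  ((algebraMap k (PadicAlgCl p)).comp (IntRing p k).subtype).codRestrict _
    fun a => ⟨hL a.1.2, norm_le_one_of_intRing a⟩

variable {σ τ : Type} [Finite σ] [Finite τ]

/-- The value of a power series in several variables over the ring of integers of `k`. -/
def evalMv (x : σ → PadicAlgCl p) (F : MvPowerSeries σ (IntRing p k)) : PadicAlgCl p :=
  ∑' d : σ →₀ ℕ, algebraMap k (PadicAlgCl p) (coeff d F : IntRing p k) *
    d.prod fun s e => x s ^ e

/-- A finite extension of `k` in which the evaluation at `x` takes place. -/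
def evalField (k : IntermediateField ℚ_[p] (PadicAlgCl p)) (x : σ → PadicAlgCl p) :
    IntermediateField ℚ_[p] (PadicAlgCl p) :=
  k ⊔ IntermediateField.adjoin ℚ_[p] (Set.range x)

instance finiteDimensional_evalField [FiniteDimensional ℚ_[p] k] (x : σ → PadicAlgCl p) :
    FiniteDimensional ℚ_[p] (evalField k x) := by
  have : FiniteDimensional ℚ_[p] (IntermediateField.adjoin ℚ_[p] (Set.range x)) :=
    IntermediateField.finiteDimensional_adjoin fun y _ => (Algebra.IsIntegral.isIntegral y)
  exact IntermediateField.finiteDimensional_sup _ _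

omit [Finite σ] in
lemma mem_evalField (x : σ → PadicAlgCl p) (i : σ) : x i ∈ evalField k x :=
  le_sup_right (a := k) (IntermediateField.subset_adjoin _ _ ⟨i, rfl⟩)

/-- The evaluation map at a point of the ring of integers of a finite extension `L` of `k`. -/
def evalIn {L : IntermediateField ℚ_[p] (PadicAlgCl p)} [FiniteDimensional ℚ_[p] L] (hL : k ≤ L)
    (x : σ → unitSubring L) (F : MvPowerSeries σ (IntRing p k)) : unitSubring L :=
  discreteEval (intRingToUnitSubring hL) x F

lemma hasEval_unitSubring {L : IntermediateField ℚ_[p] (PadicAlgCl p)}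
    {x : σ → unitSubring L} (hx : ∀ i, ‖(x i : PadicAlgCl p)‖ < 1) : HasEval x where
  hpow i := tendsto_pow_atTop_nhds_zero_of_norm_lt_one (hx i)
  tendsto_zero := by simp

lemma hasSum_evalIn {L : IntermediateField ℚ_[p] (PadicAlgCl p)} [FiniteDimensional ℚ_[p] L]
    (hL : k ≤ L) {x : σ → unitSubring L} (hx : ∀ i, ‖(x i : PadicAlgCl p)‖ < 1)
    (F : MvPowerSeries σ (IntRing p k)) :
    HasSum (fun d : σ →₀ ℕ => algebraMap k (PadicAlgCl p) (coeff d F : IntRing p k) *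
      d.prod fun s e => (x s : PadicAlgCl p) ^ e) (evalIn hL x F : PadicAlgCl p) := by
  have h := hasSum_discreteEval (intRingToUnitSubring hL) (hasEval_unitSubring hx) F
  have h2 := h.map (unitSubring L).subtype continuous_subtype_val
  convert h2 using 1
  · funext d
    simp only [Function.comp_apply, map_mul, Finsupp.prod, map_prod, map_pow]
    rfl
  · rfl

lemma evalMv_eq_evalIn {L : IntermediateField ℚ_[p] (PadicAlgCl p)} [FiniteDimensional ℚ_[p] L]
    (hL : k ≤ L) {x : σ → unitSubring L} (hx : ∀ i, ‖(x i : PadicAlgCl p)‖ < 1)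
    (F : MvPowerSeries σ (IntRing p k)) :
    evalMv (fun i => (x i : PadicAlgCl p)) F = evalIn hL x F :=
  (hasSum_evalIn hL hx F).tsum_eq

lemma evalIn_subst {L : IntermediateField ℚ_[p] (PadicAlgCl p)} [FiniteDimensional ℚ_[p] L]
    (hL : k ≤ L) {x : σ → unitSubring L} (hx : ∀ i, ‖(x i : PadicAlgCl p)‖ < 1)
    {G : τ → MvPowerSeries σ (IntRing p k)} (hG : ∀ i, constantCoeff (G i) = 0)
    (F : MvPowerSeries τ (IntRing p k)) :
    evalIn hL x (F.subst G) = evalIn hL (fun i => evalIn hL x (G i)) F := by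
  exact discreteEval_subst _ (hasEval_unitSubring hx) (hasSubst_of_constantCoeff_zero hG) F

/-- A point of the maximal ideal, regarded in a finite extension of `k`. -/
def toUnitSubring {x : σ → PadicAlgCl p} (hx : ∀ i, ‖x i‖ < 1) (i : σ) :
    unitSubring (evalField k x) :=
  ⟨x i, mem_evalField x i, (hx i).le⟩

variable [FiniteDimensional ℚ_[p] k]

lemma hasSum_evalMv {x : σ → PadicAlgCl p} (hx : ∀ i, ‖x i‖ < 1)
    (F : MvPowerSeries σ (IntRing p k)) :
    HasSum (fun d : σ →₀ ℕ => algebraMap k (PadicAlgCl p) (coeff d F : IntRing p k) *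
      d.prod fun s e => x s ^ e) (evalMv x F) :=
  (hasSum_evalIn (L := evalField k x) le_sup_left (x := toUnitSubring hx) hx F).summable.hasSum

lemma evalMv_mem_evalField {x : σ → PadicAlgCl p} (hx : ∀ i, ‖x i‖ < 1)
    (F : MvPowerSeries σ (IntRing p k)) : evalMv x F ∈ evalField k x := by
  have h := evalMv_eq_evalIn (L := evalField k x) le_sup_left (x := toUnitSubring hx) hx F
  change evalMv x F = _ at h
  rw [h]
  exact (evalIn _ _ F).2.1

/-- The value of a power series over the ring of integers of `k` at a point `x` lies in `k(x)`,
since this field is complete. -/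
lemma evalMv_mem {x : σ → PadicAlgCl p} (hx : ∀ i, ‖x i‖ < 1)
    (F : MvPowerSeries σ (IntRing p k)) (M : Subfield (PadicAlgCl p))
    (hM : ∀ a : k, (a : PadicAlgCl p) ∈ M) (hxM : ∀ i, x i ∈ M) : evalMv x F ∈ M := by
  let M' : IntermediateField ℚ_[p] (PadicAlgCl p) :=
    { M with algebraMap_mem' := fun a => hM (algebraMap ℚ_[p] k a) }
  have h1 : evalField k x ≤ M' := sup_le (fun a ha => hM ⟨a, ha⟩)
    (IntermediateField.adjoin_le_iff.mpr (by rintro _ ⟨i, rfl⟩; exact hxM i))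
  exact h1 (evalMv_mem_evalField hx F)

lemma norm_evalMv_lt_one {x : σ → PadicAlgCl p} (hx : ∀ i, ‖x i‖ < 1)
    {F : MvPowerSeries σ (IntRing p k)} (hF : constantCoeff F = 0) : ‖evalMv x F‖ < 1 := by
  classical
  let B : AddSubgroup (PadicAlgCl p) :=
    { carrier := Metric.ball 0 1
      zero_mem' := by simp
      add_mem' := fun {a b} ha hb => by
        simp only [mem_ball_zero_iff] at ha hb ⊢
        exact (IsUltrametricDist.norm_add_le_max a b).trans_lt (max_lt ha hb)
      neg_mem' := fun {a} ha => by simpa using ha }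
  have hB : IsClosed (B : Set (PadicAlgCl p)) :=
    IsUltrametricDist.isClosed_ball (0 : PadicAlgCl p) 1
  have : evalMv x F ∈ (B : Set (PadicAlgCl p)) := by
    refine hB.mem_of_tendsto (hasSum_evalMv hx F) (Filter.Eventually.of_forall fun s => ?_)
    refine B.sum_mem fun d _ => ?_
    change _ ∈ Metric.ball (0 : PadicAlgCl p) 1
    rw [mem_ball_zero_iff, norm_mul]
    by_cases hd : d = 0
    · simp [hd, hF]
    · obtain ⟨i, hi⟩ := Finsupp.support_nonempty_iff.mpr hd
      have h1 : ‖d.prod fun s e => x s ^ e‖ < 1 := by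
        rw [Finsupp.prod, norm_prod, ← Finset.mul_prod_erase _ _ hi, norm_pow]
        refine mul_lt_one_of_nonneg_of_lt_one_left (by positivity)
          (pow_lt_one₀ (norm_nonneg _) (hx i) (Finsupp.mem_support_iff.mp hi)) ?_
        refine Finset.prod_le_one (fun _ _ => norm_nonneg _) fun j _ => ?_
        rw [norm_pow]
        exact pow_le_one₀ (norm_nonneg _) (hx j).le
      exact mul_lt_one_of_nonneg_of_lt_one_right (norm_le_one_of_intRing _) (norm_nonneg _) h1
  simpa using (show evalMv x F ∈ Metric.ball (0 : PadicAlgCl p) 1 from this)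

/-- Evaluation is compatible with substitution. -/
lemma evalMv_subst {x : σ → PadicAlgCl p} (hx : ∀ i, ‖x i‖ < 1)
    {G : τ → MvPowerSeries σ (IntRing p k)} (hG : ∀ i, constantCoeff (G i) = 0)
    (F : MvPowerSeries τ (IntRing p k)) :
    evalMv x (F.subst G) = evalMv (fun i => evalMv x (G i)) F := by
  have hL : k ≤ evalField k x := le_sup_left
  have h := fun H => evalMv_eq_evalIn hL (x := toUnitSubring hx) hx H
  change ∀ H, evalMv x H = _ at h
  have h2 : ∀ i, ‖(evalIn hL (toUnitSubring hx) (G i) : PadicAlgCl p)‖ < 1 := fun i => by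
    rw [← h]; exact norm_evalMv_lt_one hx (hG i)
  rw [h, evalIn_subst hL (x := toUnitSubring hx) hx hG, ← evalMv_eq_evalIn hL h2]
  simp only [h]

lemma algEquiv_evalMv (s : PadicAlgCl p ≃ₐ[k] PadicAlgCl p) {x : σ → PadicAlgCl p}
    (hx : ∀ i, ‖x i‖ < 1) (F : MvPowerSeries σ (IntRing p k)) :
    s (evalMv x F) = evalMv (fun i => s (x i)) F := by
  have h := (hasSum_evalMv hx F).map s (continuous_algEquiv s)
  refine HasSum.unique h ?_
  have h2 := hasSum_evalMv (x := fun i => s (x i)) (fun i => by rw [norm_algEquiv]; exact hx i) F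
  convert h2 using 2 with d
  simp only [Function.comp_apply, map_mul, Finsupp.prod, map_prod, map_pow, AlgEquiv.commutes]

omit [FiniteDimensional ℚ_[p] k] in
lemma evalSeries_eq_evalMv (f : PowerSeries (IntRing p k)) (x : PadicAlgCl p) :
    evalSeries f x = evalMv (fun _ : Unit => x) f := by
  rw [evalSeries, evalMv, ← (Finsupp.uniqueEquiv (M := ℕ) ()).tsum_eq]
  refine tsum_congr fun d => ?_
  obtain ⟨n, rfl⟩ := (Finsupp.uniqueEquiv (M := ℕ) ()).symm.surjective d
  have : (Finsupp.uniqueEquiv (M := ℕ) ()).symm n = Finsupp.single () n := by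
    ext; simp
  rw [Equiv.apply_symm_apply, this, Finsupp.prod_single_index (by simp)]
  rfl

omit [FiniteDimensional ℚ_[p] k] [Finite σ] in
lemma evalMv_X (x : σ → PadicAlgCl p) (i : σ) :
    evalMv x (X i : MvPowerSeries σ (IntRing p k)) = x i := by
  classical
  rw [evalMv, tsum_eq_single (Finsupp.single i 1)]
  · simp
  · intro d hd
    rw [coeff_X, if_neg hd]
    simp

omit [FiniteDimensional ℚ_[p] k] [Finite σ] in
lemma evalMv_zero (x : σ → PadicAlgCl p) :
    evalMv x (0 : MvPowerSeries σ (IntRing p k)) = 0 := by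
  simp [evalMv]

end Evaluation

/-! ### The module of points of a Lubin–Tate formal group -/

section Points

open MvPowerSeries

variable {p : ℕ} [Fact p.Prime] {k : IntermediateField ℚ_[p] (PadicAlgCl p)}

/-- A Lubin–Tate series `φ` for a uniformizer `π` of `k`. -/
structure LubinTateDatum (k : IntermediateField ℚ_[p] (PadicAlgCl p)) where
  /-- The uniformizer. -/
  π : IntRing p k
  /-- The Lubin–Tate series. -/
  φ : PowerSeries (IntRing p k)
  base : IsLubinTateBase π (Nat.card (ResField p k))
  lift : IsFrobeniusLift π (Nat.card (ResField p k)) φ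

namespace LubinTateDatum

variable (D D' : LubinTateDatum k) {σ τ : Type} [Finite σ] [Finite τ]

/-- The formal homomorphism from `D'.φ` to `D.φ` with given linear part, when both series belong
to the same uniformizer. -/
def hom (h : D'.π = D.π) (a : σ → IntRing p k) : MvPowerSeries σ (IntRing p k) :=
  (exists_isFormalHom D.base D.lift (h ▸ D'.lift) a).choose

lemma isFormalHom_hom (h : D'.π = D.π) (a : σ → IntRing p k) :
    IsFormalHom D.φ D'.φ a (D.hom D' h a) :=
  (exists_isFormalHom D.base D.lift (h ▸ D'.lift) a).choose_spec

variable {D D'} in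
lemma hom_eq (h : D'.π = D.π) {a : σ → IntRing p k} {F : MvPowerSeries σ (IntRing p k)}
    (hF : IsFormalHom D.φ D'.φ a F) : D.hom D' h a = F :=
  (D.isFormalHom_hom D' h a).unique D.base D.lift (h ▸ D'.lift) hF

/-- The maximal ideal of the ring of integers of `PadicAlgCl p`, to be endowed with the module
structure given by the formal group of `D`. -/
@[ext]
structure Point (D : LubinTateDatum k) where
  /-- The underlying element. -/
  val : PadicAlgCl p
  norm_lt : ‖val‖ < 1

variable [FiniteDimensional ℚ_[p] k]

variable {D D'} in
/-- The operation on points given by a formal homomorphism. -/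
def mapPt (h : D'.π = D.π) (a : σ → IntRing p k) (v : σ → D'.Point) : D.Point :=
  ⟨evalMv (fun i => (v i).val) (D.hom D' h a),
    norm_evalMv_lt_one (fun i => (v i).norm_lt) (D.isFormalHom_hom D' h a).constantCoeff_eq⟩

lemma mapPt_mapPt [Fintype τ] {D D' D'' : LubinTateDatum k} (h : D'.π = D.π) (h' : D''.π = D'.π)
    (b : τ → IntRing p k) (a : τ → σ → IntRing p k) (v : σ → D''.Point) :
    mapPt h b (fun i => mapPt h' (a i) v) =
      mapPt (h'.trans h) (fun s => ∑ i, b i * a i s) v := by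
  ext
  have h1 := (D.isFormalHom_hom D' h b).comp D'.lift.constantCoeff_eq D''.lift.constantCoeff_eq
    (fun i => D'.isFormalHom_hom D'' h' (a i))
  simp only [mapPt]
  rw [hom_eq (h'.trans h) h1, evalMv_subst (fun i => (v i).norm_lt)
    (fun i => (D'.isFormalHom_hom D'' h' (a i)).constantCoeff_eq)]

lemma mapPt_single [DecidableEq σ] (i : σ) (v : σ → D.Point) :
    mapPt (rfl : D.π = D.π) (Pi.single i 1) v = v i := by
  ext
  simp only [mapPt]
  rw [hom_eq rfl (isFormalHom_X D.lift.constantCoeff_eq i), evalMv_X]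

variable {D D'}

instance : Add D.Point := ⟨fun x y => mapPt (rfl : D.π = D.π) (1 : Fin 2 → IntRing p k) ![x, y]⟩
instance : Neg D.Point := ⟨fun x => mapPt (rfl : D.π = D.π) (fun _ : Unit => -1) (fun _ => x)⟩
omit [FiniteDimensional ℚ_[p] k] in
instance : Zero D.Point := ⟨⟨0, by simp⟩⟩
instance : SMul (IntRing p k) D.Point :=
  ⟨fun a x => mapPt (rfl : D.π = D.π) (fun _ : Unit => a) (fun _ => x)⟩

lemma add_def (x y : D.Point) :
    x + y = mapPt (rfl : D.π = D.π) (1 : Fin 2 → IntRing p k) ![x, y] := rfl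

lemma neg_def (x : D.Point) :
    -x = mapPt (rfl : D.π = D.π) (fun _ : Unit => -1) (fun _ => x) := rfl

lemma smul_def (a : IntRing p k) (x : D.Point) :
    a • x = mapPt (rfl : D.π = D.π) (fun _ : Unit => a) (fun _ => x) := rfl

omit [FiniteDimensional ℚ_[p] k] in
@[simp]
lemma zero_val : (0 : D.Point).val = 0 := rfl

lemma mapPt_add (h : D'.π = D.π) (a b : σ → IntRing p k) (v : σ → D'.Point) :
    mapPt h a v + mapPt h b v = mapPt h (a + b) v := by
  have := mapPt_mapPt (rfl : D.π = D.π) h 1 ![a, b] v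
  rw [add_def]
  convert this using 2
  · funext i; fin_cases i <;> rfl
  · funext s; simp

lemma mapPt_smul (h : D'.π = D.π) (c : IntRing p k) (a : σ → IntRing p k) (v : σ → D'.Point) :
    c • mapPt h a v = mapPt h (c • a) v := by
  have := mapPt_mapPt (rfl : D.π = D.π) h (fun _ : Unit => c) (fun _ => a) v
  rw [smul_def, this]
  congr 1
  funext s
  simp

lemma mapPt_neg (h : D'.π = D.π) (a : σ → IntRing p k) (v : σ → D'.Point) :
    -mapPt h a v = mapPt h (-a) v := by
  have := mapPt_mapPt (rfl : D.π = D.π) h (fun _ : Unit => -1) (fun _ => a) v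
  rw [neg_def, this]
  congr 1
  funext s
  simp

lemma mapPt_zero (h : D'.π = D.π) (v : σ → D'.Point) :
    mapPt h (0 : σ → IntRing p k) v = 0 := by
  ext
  simp only [mapPt]
  have : IsFormalHom D.φ D'.φ (0 : σ → IntRing p k) 0 := by
    refine ⟨by simp, by simp, ?_⟩
    rw [PowerSeries.subst_zero_of_constantCoeff_zero D.lift.constantCoeff_eq,
      ← coe_substAlgHom (hasSubst_diagSubst D'.lift.constantCoeff_eq), map_zero]
  rw [hom_eq h this, evalMv_zero, zero_val]

/-- The points of the maximal ideal form a module over the ring of integers of `k`. All identities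
hold because both sides are the operation attached to the same linear form. -/
instance : AddCommGroup D.Point where
  add_assoc x y z := by
    have hx : x = mapPt rfl (Pi.single 0 1) ![x, y, z] := (mapPt_single D 0 ![x, y, z]).symm
    have hy : y = mapPt rfl (Pi.single 1 1) ![x, y, z] := (mapPt_single D 1 ![x, y, z]).symm
    have hz : z = mapPt rfl (Pi.single 2 1) ![x, y, z] := (mapPt_single D 2 ![x, y, z]).symm
    have key : mapPt (rfl : D.π = D.π) (Pi.single 0 1) ![x, y, z] +
          mapPt rfl (Pi.single 1 1) ![x, y, z] + mapPt rfl (Pi.single 2 1) ![x, y, z] =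
        mapPt rfl (Pi.single 0 1) ![x, y, z] +
          (mapPt rfl (Pi.single 1 1) ![x, y, z] + mapPt rfl (Pi.single 2 1) ![x, y, z]) := by
      simp only [mapPt_add, add_assoc]
    rwa [← hx, ← hy, ← hz] at key
  zero_add x := by
    have hx : x = mapPt rfl (Pi.single () 1) (fun _ => x) := (mapPt_single D () (fun _ => x)).symm
    rw [hx, ← mapPt_zero (rfl : D.π = D.π) (fun _ : Unit => x), mapPt_add, zero_add]
  add_zero x := by
    have hx : x = mapPt rfl (Pi.single () 1) (fun _ => x) := (mapPt_single D () (fun _ => x)).symm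
    rw [hx, ← mapPt_zero (rfl : D.π = D.π) (fun _ : Unit => x), mapPt_add, add_zero]
  add_comm x y := by
    have hx : x = mapPt rfl (Pi.single 0 1) ![x, y] := (mapPt_single D 0 ![x, y]).symm
    have hy : y = mapPt rfl (Pi.single 1 1) ![x, y] := (mapPt_single D 1 ![x, y]).symm
    calc x + y = mapPt rfl (Pi.single 0 1) ![x, y] + mapPt rfl (Pi.single 1 1) ![x, y] := by
          rw [← hx, ← hy]
      _ = mapPt rfl (Pi.single 1 1) ![x, y] + mapPt rfl (Pi.single 0 1) ![x, y] := by
          rw [mapPt_add, mapPt_add, add_comm]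
      _ = y + x := by rw [← hx, ← hy]
  neg_add_cancel x := by
    have hx : x = mapPt rfl (Pi.single () 1) (fun _ => x) := (mapPt_single D () (fun _ => x)).symm
    rw [hx, mapPt_neg, mapPt_add, neg_add_cancel, mapPt_zero]
  nsmul := nsmulRec
  zsmul := zsmulRec

instance : Module (IntRing p k) D.Point where
  one_smul x := by
    have hx : x = mapPt rfl (Pi.single () 1) (fun _ => x) := (mapPt_single D () (fun _ => x)).symm
    rw [hx, mapPt_smul, one_smul]
  mul_smul a b x := by
    have hx : x = mapPt rfl (Pi.single () 1) (fun _ => x) := (mapPt_single D () (fun _ => x)).symm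
    rw [hx, mapPt_smul, mapPt_smul, mapPt_smul, mul_smul]
  smul_zero a := by
    rw [← mapPt_zero (rfl : D.π = D.π) (fun _ : Unit => (0 : D.Point)), mapPt_smul, smul_zero]
  smul_add a x y := by
    have hx : x = mapPt rfl (Pi.single 0 1) ![x, y] := (mapPt_single D 0 ![x, y]).symm
    have hy : y = mapPt rfl (Pi.single 1 1) ![x, y] := (mapPt_single D 1 ![x, y]).symm
    have key : a • (mapPt rfl (Pi.single 0 1) ![x, y] + mapPt rfl (Pi.single 1 1) ![x, y]) =
        a • mapPt (rfl : D.π = D.π) (Pi.single 0 1) ![x, y] +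
          a • mapPt rfl (Pi.single 1 1) ![x, y] := by
      rw [mapPt_add, mapPt_smul, mapPt_smul, mapPt_smul, mapPt_add, smul_add]
    rwa [← hx, ← hy] at key
  add_smul a b x := by
    have hx : x = mapPt rfl (Pi.single () 1) (fun _ => x) := (mapPt_single D () (fun _ => x)).symm
    rw [hx, mapPt_smul, mapPt_smul, mapPt_smul, mapPt_add, add_smul]
  zero_smul x := by
    have hx : x = mapPt rfl (Pi.single () 1) (fun _ => x) := (mapPt_single D () (fun _ => x)).symm
    rw [hx, mapPt_smul, zero_smul, mapPt_zero]

omit [FiniteDimensional ℚ_[p] k] in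
lemma subst_diagSubst_unit (φ g : PowerSeries (IntRing p k)) :
    MvPowerSeries.subst (diagSubst Unit φ) g = PowerSeries.subst φ g := by
  have hdiag : diagSubst Unit φ = fun _ => (φ : MvPowerSeries Unit (IntRing p k)) := by
    funext i
    exact PowerSeries.X_subst φ
  rw [hdiag, PowerSeries.subst_def]

omit [FiniteDimensional ℚ_[p] k] in
lemma isFormalHom_unit_iff {φ ψ : PowerSeries (IntRing p k)} (a : IntRing p k)
    (g : PowerSeries (IntRing p k)) :
    IsFormalHom φ ψ (fun _ : Unit => a) g ↔ PowerSeries.constantCoeff g = 0 ∧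
      PowerSeries.coeff 1 g = a ∧ PowerSeries.subst g φ = PowerSeries.subst ψ g := by
  rw [← subst_diagSubst_unit ψ g]
  exact ⟨fun h => ⟨h.1, h.2 (), h.3⟩, fun h => ⟨h.1, fun _ => h.2.1, h.2.2⟩⟩

omit [FiniteDimensional ℚ_[p] k] in
/-- `[a]_φ` in the sense of commuting power series is the homomorphism with linear part `a`. -/
lemma isFormalMul_iff {φ : PowerSeries (IntRing p k)} (a : IntRing p k)
    (g : PowerSeries (IntRing p k)) :
    IsFormalMul φ a g ↔ IsFormalHom φ φ (fun _ : Unit => a) g := by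
  rw [IsFormalMul, PowerSeries.X_pow_dvd_iff, isFormalHom_unit_iff]
  constructor
  · rintro ⟨h1, h2⟩
    refine ⟨?_, ?_, h2⟩
    · have := h1 0 (by norm_num)
      simpa [sub_eq_zero] using this
    · have := h1 1 (by norm_num)
      simpa [sub_eq_zero] using this
  · rintro ⟨h0, h1, h2⟩
    refine ⟨fun m hm => ?_, h2⟩
    interval_cases m
    · simp [h0]
    · simp [h1]

lemma smul_val_of_isFormalHom {a : IntRing p k} {g : PowerSeries (IntRing p k)}
    (hg : IsFormalHom D.φ D.φ (fun _ : Unit => a) g) (x : D.Point) :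
    (a • x).val = evalSeries g x.val := by
  have h1 : D.hom D rfl (fun _ : Unit => a) = g := hom_eq rfl hg
  rw [evalSeries_eq_evalMv, ← h1]
  rfl

omit [FiniteDimensional ℚ_[p] k] in
lemma exists_isFormalMul (a : IntRing p k) : ∃ g, IsFormalMul D.φ a g :=
  ⟨D.hom D rfl (fun _ : Unit => a), (isFormalMul_iff a _).mpr (D.isFormalHom_hom D rfl _)⟩

/-- The uniformizer acts through `φ`. -/
lemma pi_smul_val (x : D.Point) : (D.π • x).val = evalSeries D.φ x.val :=
  smul_val_of_isFormalHom ((isFormalHom_unit_iff _ _).mpr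
    ⟨D.lift.constantCoeff_eq, D.lift.coeff_one, rfl⟩) x

lemma pi_pow_smul_val (n : ℕ) (x : D.Point) :
    (D.π ^ n • x).val = (evalSeries D.φ)^[n] x.val := by
  induction n with
  | zero => simp
  | succ n ih => rw [pow_succ', mul_smul, pi_smul_val, ih, Function.iterate_succ_apply']

lemma mapPt_val_mem (h : D'.π = D.π) (a : σ → IntRing p k) (v : σ → D'.Point)
    (M : Subfield (PadicAlgCl p)) (hM : ∀ a : k, (a : PadicAlgCl p) ∈ M)
    (hv : ∀ i, (v i).val ∈ M) : (mapPt h a v).val ∈ M :=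
  evalMv_mem (fun i => (v i).norm_lt) _ M hM hv

lemma smul_val_mem (a : IntRing p k) (x : D.Point) (M : Subfield (PadicAlgCl p))
    (hM : ∀ a : k, (a : PadicAlgCl p) ∈ M) (hx : x.val ∈ M) : (a • x).val ∈ M :=
  mapPt_val_mem _ _ _ M hM fun _ => hx

/-- The action of an automorphism over `k` on the points. -/
def gal (s : PadicAlgCl p ≃ₐ[k] PadicAlgCl p) (x : D.Point) : D.Point :=
  ⟨s x.val, by rw [norm_algEquiv]; exact x.norm_lt⟩

omit [FiniteDimensional ℚ_[p] k] in
@[simp]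
lemma gal_val (s : PadicAlgCl p ≃ₐ[k] PadicAlgCl p) (x : D.Point) : (gal s x).val = s x.val := rfl

lemma gal_mapPt (s : PadicAlgCl p ≃ₐ[k] PadicAlgCl p) (h : D'.π = D.π) (a : σ → IntRing p k)
    (v : σ → D'.Point) : gal s (mapPt h a v) = mapPt h a fun i => gal s (v i) := by
  ext
  exact algEquiv_evalMv s (fun i => (v i).norm_lt) _

lemma gal_add (s : PadicAlgCl p ≃ₐ[k] PadicAlgCl p) (x y : D.Point) :
    gal s (x + y) = gal s x + gal s y := by
  rw [add_def, gal_mapPt, add_def]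
  congr 1
  funext i
  fin_cases i <;> rfl

lemma gal_smul (s : PadicAlgCl p ≃ₐ[k] PadicAlgCl p) (a : IntRing p k) (x : D.Point) :
    gal s (a • x) = a • gal s x := by
  rw [smul_def, gal_mapPt, smul_def]

omit [FiniteDimensional ℚ_[p] k] in
lemma gal_mul (s t : PadicAlgCl p ≃ₐ[k] PadicAlgCl p) (x : D.Point) :
    gal (s * t) x = gal s (gal t x) := rfl

end LubinTateDatum

end Points

/-! ### Residue fields and the Frobenius map -/

section Residue

variable {p : ℕ} [Fact p.Prime]

lemma mem_maximalIdeal_iff {L : Type*} [Field L] [Algebra L (PadicAlgCl p)] (a : IntRing p L) :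
    a ∈ IsLocalRing.maximalIdeal (IntRing p L) ↔ ‖algebraMap L (PadicAlgCl p) a‖ < 1 := by
  rw [IsLocalRing.mem_maximalIdeal, mem_nonunits_iff, ← not_le, not_iff_not]
  constructor
  · rintro ⟨u, rfl⟩
    have h1 := norm_le_one_of_intRing (p := p) (u⁻¹ : (IntRing p L)ˣ).1
    have h2 : algebraMap L (PadicAlgCl p) u.1 * algebraMap L (PadicAlgCl p) (u⁻¹).1 = 1 := by
      rw [← map_mul, ← map_one (algebraMap L (PadicAlgCl p))]
      congr 1
      exact congrArg Subtype.val u.mul_inv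
    have h3 := congrArg norm h2
    rw [norm_mul, norm_one] at h3
    rw [← h3]
    exact mul_le_of_le_one_right (norm_nonneg _) h1
  · intro h
    have h0 : (a : L) ≠ 0 := by
      rintro h0
      rw [h0, map_zero, norm_zero] at h
      exact absurd h (by norm_num)
    have hinv : (a : L)⁻¹ ∈ IntRing p L := by
      rw [mem_intRing_iff, map_inv₀, norm_inv]
      exact inv_le_one_of_one_le₀ h
    exact IsUnit.of_mul_eq_one ⟨(a : L)⁻¹, hinv⟩ (Subtype.ext (mul_inv_cancel₀ h0))

lemma residue_eq_iff {L : Type*} [Field L] [Algebra L (PadicAlgCl p)] (a b : IntRing p L) :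
    IsLocalRing.residue (IntRing p L) a = IsLocalRing.residue (IntRing p L) b ↔
      ‖algebraMap L (PadicAlgCl p) a - algebraMap L (PadicAlgCl p) b‖ < 1 := by
  rw [← sub_eq_zero, ← map_sub, IsLocalRing.residue_eq_zero_iff, mem_maximalIdeal_iff, ← map_sub]
  rfl

lemma mem_intRing_padicAlgCl_iff {b : PadicAlgCl p} : b ∈ IntRing p (PadicAlgCl p) ↔ ‖b‖ ≤ 1 := by
  rw [mem_intRing_iff, Algebra.algebraMap_self_apply]

lemma residue_padicAlgCl_eq_iff (a b : IntRing p (PadicAlgCl p)) :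
    IsLocalRing.residue (IntRing p (PadicAlgCl p)) a =
      IsLocalRing.residue (IntRing p (PadicAlgCl p)) b ↔
      ‖(a : PadicAlgCl p) - (b : PadicAlgCl p)‖ < 1 := by
  rw [residue_eq_iff, Algebra.algebraMap_self_apply, Algebra.algebraMap_self_apply]

lemma norm_natCast_p_lt_one : ‖(p : PadicAlgCl p)‖ < 1 := by
  have h : (p : PadicAlgCl p) = algebraMap ℚ_[p] (PadicAlgCl p) p := by simp
  rw [h, norm_algebraMap', Padic.norm_p]
  exact inv_lt_one_of_one_lt₀ (by exact_mod_cast (Fact.out : p.Prime).one_lt)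

instance charP_resField (L : Type*) [Field L] [Algebra L (PadicAlgCl p)] :
    CharP (ResField p L) p := by
  rw [CharP.charP_iff_prime_eq_zero Fact.out]
  rw [← map_natCast (IsLocalRing.residue (IntRing p L)), IsLocalRing.residue_eq_zero_iff,
    mem_maximalIdeal_iff]
  simpa using norm_natCast_p_lt_one

/-- The elements of the residue field of `E` are fixed by the `Q`-power map. -/
def FrobeniusFixed (p : ℕ) [Fact p.Prime] (E : Type*) [Field E] [Algebra E (PadicAlgCl p)]
    (Q : ℕ) : Prop :=
  ∀ x : ResField p E, x ^ Q = x

lemma frobeniusFixed_iff {E : Type*} [Field E] [Algebra E (PadicAlgCl p)] {Q : ℕ} :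
    FrobeniusFixed p E Q ↔ ∀ e : E, ‖algebraMap E (PadicAlgCl p) e‖ ≤ 1 →
      ‖algebraMap E (PadicAlgCl p) e ^ Q - algebraMap E (PadicAlgCl p) e‖ < 1 := by
  constructor
  · intro h e he
    have := h (IsLocalRing.residue _ ⟨e, (mem_intRing_iff e).mpr he⟩)
    rw [← map_pow, residue_eq_iff] at this
    simpa using this
  · intro h x
    obtain ⟨a, rfl⟩ := IsLocalRing.residue_surjective x
    rw [← map_pow, residue_eq_iff]
    simpa using h a (norm_le_one_of_intRing a)

lemma FrobeniusFixed.finite {E : Type*} [Field E] [Algebra E (PadicAlgCl p)] {Q : ℕ}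
    (h : FrobeniusFixed p E Q) (hQ : 1 < Q) : Finite (ResField p E) := by
  have h1 : ((Polynomial.X ^ Q - Polynomial.X : Polynomial (ResField p E)).rootSet
      (ResField p E)).Finite := Polynomial.rootSet_finite _ _
  refine Set.finite_univ_iff.mp (h1.subset fun x _ => ?_)
  rw [Polynomial.mem_rootSet]
  exact ⟨FiniteField.X_pow_card_sub_X_ne_zero _ hQ, by simp [h x]⟩

lemma frobeniusFixed_natCard (E : Type*) [Field E] [Algebra E (PadicAlgCl p)]
    [Finite (ResField p E)] : FrobeniusFixed p E (Nat.card (ResField p E)) := by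
  intro x
  have := Fintype.ofFinite (ResField p E)
  rw [Nat.card_eq_fintype_card, FiniteField.pow_card]

lemma exists_natCard_resField (E : Type*) [Field E] [Algebra E (PadicAlgCl p)]
    [Finite (ResField p E)] : ∃ f ≠ 0, Nat.card (ResField p E) = p ^ f := by
  have := Fintype.ofFinite (ResField p E)
  obtain ⟨n, -, hn⟩ := FiniteField.card (ResField p E) p
  exact ⟨n, n.ne_zero, by rw [Nat.card_eq_fintype_card, hn]⟩

lemma norm_algEquiv' {E : Type*} [Field E] [Algebra E (PadicAlgCl p)] [Algebra ℚ_[p] E]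
    [IsScalarTower ℚ_[p] E (PadicAlgCl p)] (s : PadicAlgCl p ≃ₐ[E] PadicAlgCl p)
    (x : PadicAlgCl p) : ‖s x‖ = ‖x‖ :=
  (spectralNorm_eq_of_equiv (s.restrictScalars ℚ_[p]) x).symm

section Conjugates

variable {E : Type*} [Field E] [Algebra E (PadicAlgCl p)] [Algebra ℚ_[p] E]
  [IsScalarTower ℚ_[p] E (PadicAlgCl p)]

lemma normal_padicAlgCl (p : ℕ) [Fact p.Prime] (E : Type*) [Field E] [Algebra E (PadicAlgCl p)]
    [Algebra ℚ_[p] E] [IsScalarTower ℚ_[p] E (PadicAlgCl p)] : Normal E (PadicAlgCl p) := by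
  have : Algebra.IsAlgebraic E (PadicAlgCl p) := Algebra.IsAlgebraic.tower_top (K := ℚ_[p]) E
  exact { toIsAlgebraic := this, splits' := fun x => IsAlgClosed.splits _ }

/-- The minimal polynomial over `E` of an integral element `b` is the product of the linear factors
attached to the conjugates of `b`, which are integral. -/
lemma exists_integral_factorization {b : PadicAlgCl p} (hb : ‖b‖ ≤ 1) :
    ∃ R : Multiset (IntRing p (PadicAlgCl p)),
      (∀ r ∈ R, ∃ s : PadicAlgCl p ≃ₐ[E] PadicAlgCl p, s b = r) ∧
      ((R.map fun r => Polynomial.X - Polynomial.C r).prod).map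
        (IntRing p (PadicAlgCl p)).subtype = (minpoly E b).map (algebraMap E (PadicAlgCl p)) := by
  have hnorm := normal_padicAlgCl p E
  set m := (minpoly E b).map (algebraMap E (PadicAlgCl p)) with hm
  have hmonic : m.Monic := (minpoly.monic (hnorm.isIntegral b)).map _
  have hsplit : m.Splits := IsAlgClosed.splits m
  have hroot : ∀ r ∈ m.roots, ∃ s : PadicAlgCl p ≃ₐ[E] PadicAlgCl p, s b = r := by
    intro r hr
    have h2 := (Polynomial.mem_roots hmonic.ne_zero).mp hr
    rw [hm, Polynomial.IsRoot, Polynomial.eval_map_algebraMap] at h2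
    exact minpoly.exists_algEquiv_of_root' (hnorm.isAlgebraic b) h2
  have hrint : ∀ r ∈ m.roots, r ∈ IntRing p (PadicAlgCl p) := by
    intro r hr
    obtain ⟨s, rfl⟩ := hroot r hr
    rw [mem_intRing_padicAlgCl_iff]
    rwa [norm_algEquiv']
  obtain ⟨R, hR⟩ : ∃ R : Multiset (IntRing p (PadicAlgCl p)),
      R.map (IntRing p (PadicAlgCl p)).subtype = m.roots :=
    CanLift.prf (β := Multiset (IntRing p (PadicAlgCl p))) m.roots hrint
  refine ⟨R, fun r hr => ?_, ?_⟩
  · exact hroot r (hR ▸ Multiset.mem_map_of_mem _ hr)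
  · rw [hsplit.eq_prod_roots_of_monic hmonic, Polynomial.map_multiset_prod, Multiset.map_map,
      ← hR, Multiset.map_map]
    congr 1
    refine Multiset.map_congr rfl fun r _ => ?_
    rw [Function.comp_apply, Function.comp_apply, Polynomial.map_sub, Polynomial.map_X,
      Polynomial.map_C]

/-- The minimal polynomial over `E` of an integral element `b` reduces to a polynomial whose roots
are the residues of the conjugates of `b`; if the residue field of `E` is fixed by the `Q`-power
map, so is the reduced polynomial, and its roots are permuted by this map. -/
lemma exists_reduction {Q f : ℕ} (hQ : Q = p ^ f) (hE : FrobeniusFixed p E Q)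
    {b : PadicAlgCl p} (hb : b ∈ IntRing p (PadicAlgCl p)) :
    ∃ P : Polynomial (ResField p (PadicAlgCl p)), P ≠ 0 ∧ P.natDegree = (minpoly E b).natDegree ∧
      (∀ x, P.IsRoot x → P.IsRoot (x ^ Q)) ∧ P.IsRoot (IsLocalRing.residue _ ⟨b, hb⟩) ∧
      (∀ x, P.IsRoot x → ∃ s : PadicAlgCl p ≃ₐ[E] PadicAlgCl p,
        ∃ h : s b ∈ IntRing p (PadicAlgCl p), IsLocalRing.residue _ ⟨s b, h⟩ = x) := by
  obtain ⟨R, hR, hMm⟩ := exists_integral_factorization (E := E) (mem_intRing_padicAlgCl_iff.mp hb)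
  have hint : IsIntegral E b := (normal_padicAlgCl p E).isIntegral b
  set M : Polynomial (IntRing p (PadicAlgCl p)) :=
    (R.map fun r => Polynomial.X - Polynomial.C r).prod with hM
  have hMmonic : M.Monic := Polynomial.monic_multiset_prod_of_monic _ _
    fun r _ => Polynomial.monic_X_sub_C r
  set P := M.map (IsLocalRing.residue (IntRing p (PadicAlgCl p))) with hP
  have hPmonic : P.Monic := hMmonic.map _
  have hcoeff : P.map (iterateFrobenius (ResField p (PadicAlgCl p)) p f) = P := by
    ext i
    rw [Polynomial.coeff_map, iterateFrobenius_def, ← hQ, hP, Polynomial.coeff_map, ← map_pow,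
      residue_padicAlgCl_eq_iff]
    have h1 : ((M.coeff i : IntRing p (PadicAlgCl p)) : PadicAlgCl p) =
        algebraMap E (PadicAlgCl p) ((minpoly E b).coeff i) := by
      rw [← Polynomial.coeff_map, ← hMm, Polynomial.coeff_map]
      rfl
    have h2 := frobeniusFixed_iff.mp hE ((minpoly E b).coeff i)
      (by rw [← h1]; exact mem_intRing_padicAlgCl_iff.mp (M.coeff i).2)
    rw [← h1] at h2
    exact h2
  refine ⟨P, hPmonic.ne_zero, ?_, fun x hx => ?_, ?_, fun x hx => ?_⟩
  · rw [hP, hMmonic.natDegree_map, ← hMmonic.natDegree_map (IntRing p (PadicAlgCl p)).subtype,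
      hMm, (minpoly.monic hint).natDegree_map]
  · have h := congrArg (iterateFrobenius (ResField p (PadicAlgCl p)) p f) hx
    rw [map_zero, ← Polynomial.eval_map_apply, hcoeff, iterateFrobenius_def, ← hQ] at h
    exact h
  · have h1 : M.IsRoot ⟨b, hb⟩ := by
      have : (IntRing p (PadicAlgCl p)).subtype (M.eval ⟨b, hb⟩) = 0 := by
        rw [← Polynomial.eval_map_apply, hMm]
        exact (Polynomial.eval_map_algebraMap _ _).trans (minpoly.aeval E b)
      exact Subtype.ext this
    exact h1.map
  · rw [Polynomial.IsRoot, hP, hM, Polynomial.map_multiset_prod, Multiset.map_map,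
      Polynomial.eval_multiset_prod, Multiset.map_map, Multiset.prod_eq_zero_iff,
      Multiset.mem_map] at hx
    obtain ⟨r, hr, hrx⟩ := hx
    obtain ⟨s, hs⟩ := hR r hr
    refine ⟨s, hs ▸ r.2, ?_⟩
    have h1 : x - IsLocalRing.residue _ r = 0 := by
      rw [← hrx]
      simp only [Function.comp_apply, Polynomial.map_sub, Polynomial.map_X, Polynomial.map_C,
        Polynomial.eval_sub, Polynomial.eval_X, Polynomial.eval_C]
    rw [sub_eq_zero.mp h1]
    congr 1
    exact Subtype.ext hs

/-- If the residue field of `E` is fixed by the `Q`-power map, the `Q`-power of the residue of `b`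
is the residue of a conjugate of `b` over `E`. -/
lemma exists_algEquiv_pow_congr {Q f : ℕ} (hQ : Q = p ^ f) (hE : FrobeniusFixed p E Q)
    {b : PadicAlgCl p} (hb : ‖b‖ ≤ 1) :
    ∃ s : PadicAlgCl p ≃ₐ[E] PadicAlgCl p, ‖s b - b ^ Q‖ < 1 := by
  obtain ⟨P, -, -, h1, h2, h3⟩ := exists_reduction hQ hE (mem_intRing_padicAlgCl_iff.mpr hb)
  obtain ⟨s, h, hs⟩ := h3 _ (h1 _ h2)
  refine ⟨s, ?_⟩
  rw [← map_pow, residue_padicAlgCl_eq_iff] at hs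
  simpa using hs

/-- Elements of degree at most `N` over `E` have residues of degree at most `N` over the residue
field of `E`. -/
lemma norm_pow_sub_lt_one_of_natDegree_le {Q f N : ℕ} (hQ : Q = p ^ f)
    (hE : FrobeniusFixed p E Q) {b : PadicAlgCl p} (hb : ‖b‖ ≤ 1)
    (hN : (minpoly E b).natDegree ≤ N) : ‖b ^ (Q ^ N.factorial) - b‖ < 1 := by
  classical
  obtain ⟨P, hP0, hdeg, h1, h2, -⟩ := exists_reduction hQ hE (mem_intRing_padicAlgCl_iff.mpr hb)
  set x := IsLocalRing.residue _ (⟨b, _⟩ : IntRing p (PadicAlgCl p)) with hx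
  have hiter : ∀ i, P.IsRoot (x ^ Q ^ i) := by
    intro i
    induction i with
    | zero => simpa using h2
    | succ i ih => rw [pow_succ, pow_mul]; exact h1 _ ih
  have hcard : P.roots.toFinset.card < (Finset.range (N + 1)).card := by
    rw [Finset.card_range]
    have := (Multiset.toFinset_card_le P.roots).trans (Polynomial.card_roots' P)
    omega
  obtain ⟨i, hi, j, hj, hij, heq⟩ := Finset.exists_ne_map_eq_of_card_lt_of_maps_to hcard
    (f := fun i => x ^ Q ^ i) fun i _ => by simpa [hP0] using hiter i
  have key : ∀ {i j : ℕ}, i < j → j ≤ N → x ^ Q ^ i = x ^ Q ^ j →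
      x ^ Q ^ N.factorial = x := by
    intro i j hij hj heq
    obtain ⟨d, rfl⟩ := Nat.exists_eq_add_of_lt hij
    have hd : x ^ Q ^ (d + 1) = x := by
      apply iterateFrobenius_inj (ResField p (PadicAlgCl p)) p (f * i)
      rw [iterateFrobenius_def, iterateFrobenius_def, pow_mul, ← hQ, ← pow_mul, ← pow_add, heq]
      congr 2
      omega
    have hmul : ∀ n, x ^ Q ^ ((d + 1) * n) = x := by
      intro n
      induction n with
      | zero => simp
      | succ n ih => rw [mul_add, mul_one, pow_add, pow_mul, ih, hd]
    obtain ⟨n, hn⟩ := Nat.dvd_factorial (Nat.succ_pos d) (show d + 1 ≤ N by omega)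
    rw [hn]
    exact hmul n
  have hfin : x ^ Q ^ N.factorial = x := by
    rw [Finset.mem_range] at hi hj
    rcases Nat.lt_or_gt_of_ne hij with h | h
    · exact key h (by omega) heq
    · exact key h (by omega) heq.symm
  rw [hx, ← map_pow, residue_padicAlgCl_eq_iff] at hfin
  simpa using hfin

end Conjugates

lemma frobeniusFixed_padic : FrobeniusFixed p ℚ_[p] p := by
  rw [frobeniusFixed_iff]
  intro e he
  rw [norm_algebraMap'] at he
  rw [← map_pow, ← map_sub, norm_algebraMap']
  let z : ℤ_[p] := ⟨e, he⟩
  have h : z ^ p - z ∈ IsLocalRing.maximalIdeal ℤ_[p] := by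
    rw [← PadicInt.ker_toZMod, RingHom.mem_ker, map_sub, map_pow, ZMod.pow_card, sub_self]
  rw [IsLocalRing.mem_maximalIdeal, PadicInt.mem_nonunits] at h
  exact h

variable {k : IntermediateField ℚ_[p] (PadicAlgCl p)}

instance finite_resField [FiniteDimensional ℚ_[p] k] : Finite (ResField p k) := by
  have hp : 1 < p := (Fact.out : p.Prime).one_lt
  have h : FrobeniusFixed p k (p ^ (Module.finrank ℚ_[p] k).factorial) := by
    rw [frobeniusFixed_iff]
    intro e he
    refine norm_pow_sub_lt_one_of_natDegree_le (f := 1) (by simp) frobeniusFixed_padic he ?_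
    rw [minpoly.algebraMap_eq (algebraMap k (PadicAlgCl p)).injective]
    exact minpoly.natDegree_le e
  exact h.finite (Nat.one_lt_pow (Nat.factorial_ne_zero _) hp)

/-- The uniformizers of a finite extension of `ℚ_[p]` satisfy the assumptions of the Lubin–Tate
construction. -/
lemma isLubinTateBase_of_maximalIdeal_eq [FiniteDimensional ℚ_[p] k] {π : IntRing p k}
    (hπ : IsLocalRing.maximalIdeal (IntRing p k) = Ideal.span {π}) :
    IsLubinTateBase π (Nat.card (ResField p k)) := by
  have hmem : ∀ a : IntRing p k, π ∣ a ↔ ‖algebraMap k (PadicAlgCl p) a‖ < 1 := fun a => by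
    rw [← mem_maximalIdeal_iff, hπ, Ideal.mem_span_singleton]
  have hp : π ∣ ((p : ℕ) : IntRing p k) := by
    rw [hmem]
    simpa using norm_natCast_p_lt_one
  have hunit : ¬ IsUnit π := by
    rw [← mem_nonunits_iff, ← IsLocalRing.mem_maximalIdeal, hπ]
    exact Ideal.mem_span_singleton_self π
  refine ⟨?_, fun n hn => ?_, hunit, ⟨p, Fact.out, hp, exists_natCard_resField k⟩, fun a => ?_⟩
  · rintro rfl
    rw [zero_dvd_iff] at hp
    have : ((p : ℕ) : k) = 0 := by
      have := congrArg (fun a : IntRing p k => (a : k)) hp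
      simpa using this
    exact (Fact.out : p.Prime).ne_zero (by exact_mod_cast this)
  · by_contra h
    apply IsLocalRing.maximalIdeal.isMaximal (IntRing p k) |>.ne_top
    rw [Ideal.eq_top_iff_one]
    have h1 := (IsLocalRing.mem_maximalIdeal (1 - π ^ n)).mpr h
    have h2 : π ^ n ∈ IsLocalRing.maximalIdeal (IntRing p k) :=
      Ideal.pow_mem_of_mem _ ((IsLocalRing.mem_maximalIdeal π).mpr hunit) n (by omega)
    simpa using add_mem h1 h2
  · rw [hmem]
    simpa using frobeniusFixed_iff.mp (frobeniusFixed_natCard k) a (norm_le_one_of_intRing a)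

end Residue

/-! ### The Lubin–Tate tower of the polynomial `X ^ q + π X` -/

section Tower

open Polynomial

variable {p : ℕ} [Fact p.Prime] {k : IntermediateField ℚ_[p] (PadicAlgCl p)}

/-- The Lubin–Tate series `X ^ q + π X`. -/
def basicSeries (π : IntRing p k) : PowerSeries (IntRing p k) :=
  PowerSeries.X ^ Nat.card (ResField p k) + PowerSeries.C π * PowerSeries.X

lemma one_lt_natCard_resField (p : ℕ) [Fact p.Prime] (k : IntermediateField ℚ_[p] (PadicAlgCl p))
    [FiniteDimensional ℚ_[p] k] : 1 < Nat.card (ResField p k) := by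
  obtain ⟨f, hf, h⟩ := exists_natCard_resField (p := p) k
  rw [h]
  exact Nat.one_lt_pow hf (Fact.out : p.Prime).one_lt

variable [FiniteDimensional ℚ_[p] k]

lemma isFrobeniusLift_basicSeries (π : IntRing p k) :
    IsFrobeniusLift π (Nat.card (ResField p k)) (basicSeries π) where
  C_dvd := by simp [basicSeries]
  constantCoeff_eq := by
    have := one_lt_natCard_resField p k
    simp [basicSeries, show Nat.card (ResField p k) ≠ 0 by omega]
  coeff_one := by
    have := one_lt_natCard_resField p k
    rw [basicSeries, map_add, PowerSeries.coeff_X_pow, if_neg (by omega), zero_add,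
      PowerSeries.coeff_C_mul, PowerSeries.coeff_one_X, mul_one]

lemma evalSeries_basicSeries (π : IntRing p k) (x : PadicAlgCl p) :
    evalSeries (basicSeries π) x =
      x ^ Nat.card (ResField p k) + algebraMap k (PadicAlgCl p) π * x := by
  have hq := one_lt_natCard_resField p k
  rw [evalSeries, tsum_eq_sum (s := {Nat.card (ResField p k), 1}), Finset.sum_pair (by omega)]
  · simp only [basicSeries, map_add, PowerSeries.coeff_X_pow, PowerSeries.coeff_C_mul,
      PowerSeries.coeff_X]
    simp [hq.ne', hq.ne]
  · intro i hi
    simp only [Finset.mem_insert, Finset.mem_singleton, not_or] at hi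
    simp only [basicSeries, map_add, PowerSeries.coeff_X_pow, PowerSeries.coeff_C_mul,
      PowerSeries.coeff_X, if_neg hi.1, if_neg hi.2]
    simp

omit [FiniteDimensional ℚ_[p] k] in
lemma norm_pi_lt_one {π : IntRing p k}
    (hπ : IsLocalRing.maximalIdeal (IntRing p k) = Ideal.span {π}) :
    ‖algebraMap k (PadicAlgCl p) π‖ < 1 := by
  rw [← mem_maximalIdeal_iff, hπ]
  exact Ideal.mem_span_singleton_self π

lemma norm_pi_pos {π : IntRing p k}
    (hπ : IsLocalRing.maximalIdeal (IntRing p k) = Ideal.span {π}) :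
    0 < ‖algebraMap k (PadicAlgCl p) π‖ := by
  rw [norm_pos_iff, ne_eq, map_eq_zero]
  exact fun h => (isLubinTateBase_of_maximalIdeal_eq hπ).ne_zero (Subtype.ext h)

/-- The absolute values of `k` are the powers of that of a uniformizer. -/
lemma exists_norm_eq_zpow {π : IntRing p k}
    (hπ : IsLocalRing.maximalIdeal (IntRing p k) = Ideal.span {π}) {c : k} (hc : c ≠ 0) :
    ∃ m : ℤ, ‖algebraMap k (PadicAlgCl p) c‖ = ‖algebraMap k (PadicAlgCl p) π‖ ^ m := by
  set ϖ := ‖algebraMap k (PadicAlgCl p) π‖ with hϖ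
  have h0 : 0 < ϖ := norm_pi_pos hπ
  have h1 : ϖ < 1 := norm_pi_lt_one hπ
  have hcpos : 0 < ‖algebraMap k (PadicAlgCl p) c‖ := by
    rw [norm_pos_iff, ne_eq, map_eq_zero]; exact hc
  obtain ⟨n, hn1, hn2⟩ := exists_mem_Ioc_zpow hcpos ((one_lt_inv₀ h0).mpr h1)
  refine ⟨-(n + 1), ?_⟩
  have hpow : 0 < ϖ ^ (n + 1) := zpow_pos h0 _
  have hnorm : ‖algebraMap k (PadicAlgCl p) (c * (π : k) ^ (n + 1))‖ =
      ‖algebraMap k (PadicAlgCl p) c‖ * ϖ ^ (n + 1) := by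
    rw [map_mul, norm_mul, map_zpow₀, norm_zpow]
  have hle : ‖algebraMap k (PadicAlgCl p) (c * (π : k) ^ (n + 1))‖ ≤ 1 := by
    rw [hnorm]
    rwa [inv_zpow, ← one_div, le_div_iff₀ hpow] at hn2
  have hnot : ¬ ‖algebraMap k (PadicAlgCl p) (c * (π : k) ^ (n + 1))‖ < 1 := by
    intro hlt
    have := (mem_maximalIdeal_iff (⟨_, (mem_intRing_iff _).mpr hle⟩ : IntRing p k)).mpr hlt
    rw [hπ, Ideal.mem_span_singleton] at this
    obtain ⟨b, hb⟩ := this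
    have hb' : c * (π : k) ^ (n + 1) = (π : k) * b := congrArg Subtype.val hb
    rw [hb', map_mul, norm_mul, ← hϖ] at hnorm
    have hb1 := norm_le_one_of_intRing b
    rw [inv_zpow, ← one_div, div_lt_iff₀ (zpow_pos h0 _)] at hn1
    rw [zpow_add_one₀ h0.ne', ← mul_assoc] at hnorm
    nlinarith
  have heq := le_antisymm hle (not_lt.mp hnot)
  rw [hnorm] at heq
  rw [zpow_neg]
  exact eq_inv_of_mul_eq_one_left heq

section Ramified

variable {π : IntRing p k} (hπ : IsLocalRing.maximalIdeal (IntRing p k) = Ideal.span {π})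
  {t : PadicAlgCl p} {d : ℕ} (ht : ‖t‖ ^ d = ‖algebraMap k (PadicAlgCl p) π‖)

include hπ ht

lemma norm_pow_mul_ne {c c' : k} (hc : c ≠ 0) (hc' : c' ≠ 0) {i j : ℕ} (hi : i < d) (hj : j < d)
    (hij : i ≠ j) :
    ‖algebraMap k (PadicAlgCl p) c * t ^ i‖ ≠ ‖algebraMap k (PadicAlgCl p) c' * t ^ j‖ := by
  obtain ⟨m, hm⟩ := exists_norm_eq_zpow hπ hc
  obtain ⟨m', hm'⟩ := exists_norm_eq_zpow hπ hc'
  have h0 := norm_pi_pos hπ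
  have h1 := norm_pi_lt_one hπ
  intro h
  have h2 := congrArg (· ^ d) h
  simp only [norm_mul, norm_pow, hm, hm', mul_pow] at h2
  rw [pow_right_comm, pow_right_comm ‖t‖ j, ht, ← zpow_natCast, ← zpow_natCast, ← zpow_natCast,
    ← zpow_natCast, ← zpow_mul, ← zpow_mul, ← zpow_add₀ h0.ne', ← zpow_add₀ h0.ne'] at h2
  have h3 := zpow_right_injective₀ h0 h1.ne h2
  have h4 : ((i : ℤ) - j) = d * (m' - m) := by linear_combination h3
  have h5 : (i : ℤ) - j ≠ 0 := by omega
  have h6 : (d : ℤ) ∣ (i : ℤ) - j := ⟨_, h4⟩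
  have h7 := Int.le_of_dvd (abs_pos.mpr h5) ((dvd_abs _ _).mpr h6)
  rcases abs_cases ((i : ℤ) - j) with h | h <;> omega

/-- If `|t| ^ d = |π|`, the terms of a polynomial of degree less than `d` in `t` over `k` have
distinct absolute values, so that none of them exceeds the sum. -/
lemma norm_term_le_norm_aeval {P : k[X]} (hP : P.natDegree < d) {i : ℕ} (hi : i < d) :
    ‖algebraMap k (PadicAlgCl p) (P.coeff i) * t ^ i‖ ≤ ‖aeval t P‖ := by
  obtain ⟨j, hj, hmax⟩ := Finset.exists_max_image (Finset.range d)
    (fun i => ‖algebraMap k (PadicAlgCl p) (P.coeff i) * t ^ i‖) ⟨i, Finset.mem_range.mpr hi⟩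
  refine (hmax i (Finset.mem_range.mpr hi)).trans ?_
  rw [aeval_eq_sum_range' hP]
  simp only [Algebra.smul_def]
  rw [← Finset.add_sum_erase _ _ hj]
  by_cases hj0 : algebraMap k (PadicAlgCl p) (P.coeff j) * t ^ j = 0
  · rw [hj0, norm_zero]; exact norm_nonneg _
  have hpos := norm_pos_iff.mpr hj0
  have hlt : ‖∑ x ∈ (Finset.range d).erase j,
      algebraMap k (PadicAlgCl p) (P.coeff x) * t ^ x‖ <
        ‖algebraMap k (PadicAlgCl p) (P.coeff j) * t ^ j‖ := by
    rcases ((Finset.range d).erase j).eq_empty_or_nonempty with he | he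
    · rw [he, Finset.sum_empty, norm_zero]; exact hpos
    · obtain ⟨l, hl, hle⟩ := IsUltrametricDist.exists_norm_finsetSum_le_of_nonempty he
        (fun x => algebraMap k (PadicAlgCl p) (P.coeff x) * t ^ x)
      refine hle.trans_lt ?_
      have hl' := Finset.mem_of_mem_erase hl
      by_cases hl0 : P.coeff l = 0
      · rw [hl0, map_zero, zero_mul, norm_zero]; exact hpos
      · refine lt_of_le_of_ne (hmax l hl') (norm_pow_mul_ne hπ ht hl0 ?_
          (Finset.mem_range.mp hl') (Finset.mem_range.mp hj) (Finset.ne_of_mem_erase hl))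
        rintro h0
        exact hj0 (by rw [h0, map_zero, zero_mul])
  rw [IsUltrametricDist.norm_add_eq_max_of_norm_ne_norm hlt.ne', max_eq_left hlt.le]

lemma le_natDegree_minpoly (hint : IsIntegral k t) (ht0 : t ≠ 0) :
    d ≤ (minpoly k t).natDegree := by
  by_contra! h
  have h1 := norm_term_le_norm_aeval hπ ht h (i := (minpoly k t).natDegree) h
  rw [minpoly.aeval, norm_zero, coeff_natDegree, (minpoly.monic hint).leadingCoeff, map_one,
    one_mul, norm_pow] at h1
  exact absurd h1 (not_le.mpr (pow_pos (norm_pos_iff.mpr ht0) _))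

/-- If `t` has degree `d` over `k` and `|t| ^ d = |π|`, then `k(t)` is totally ramified over `k`. -/
lemma exists_norm_sub_lt_one (hint : IsIntegral k t) (hd : (minpoly k t).natDegree = d)
    {e : PadicAlgCl p} (he : e ∈ IntermediateField.adjoin k {t}) (he1 : ‖e‖ ≤ 1) :
    ∃ c : k, ‖algebraMap k (PadicAlgCl p) c‖ ≤ 1 ∧ ‖e - algebraMap k (PadicAlgCl p) c‖ < 1 := by
  have h0 := norm_pi_pos hπ
  have h1 := norm_pi_lt_one hπ
  have hd0 : 0 < d := hd ▸ minpoly.natDegree_pos hint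
  rw [← IntermediateField.mem_toSubalgebra,
    IntermediateField.adjoin_simple_toSubalgebra_of_isAlgebraic hint.isAlgebraic,
    Algebra.adjoin_singleton_eq_range_aeval] at he
  obtain ⟨P', rfl⟩ := he
  obtain ⟨P, hP, hPe⟩ : ∃ P : k[X], P.natDegree < d ∧ aeval t P = aeval t P' := by
    refine ⟨P' %ₘ minpoly k t, hd ▸ natDegree_modByMonic_lt _ (minpoly.monic hint)
      (minpoly.ne_one k t), ?_⟩
    exact aeval_modByMonic_eq_self_of_root (minpoly.aeval k t)
  change ‖aeval t P'‖ ≤ 1 at he1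
  change ∃ c : k, _ ∧ ‖aeval t P' - _‖ < 1
  rw [← hPe] at he1 ⊢
  have hterm := fun {i : ℕ} (hi : i < d) => (norm_term_le_norm_aeval hπ ht hP hi).trans he1
  refine ⟨P.coeff 0, by simpa using hterm hd0, ?_⟩
  rw [aeval_eq_sum_range' hP, ← Finset.add_sum_erase _ _ (Finset.mem_range.mpr hd0)]
  simp only [Algebra.smul_def, pow_zero, mul_one, add_sub_cancel_left]
  rcases ((Finset.range d).erase 0).eq_empty_or_nonempty with hemp | hne
  · rw [hemp, Finset.sum_empty, norm_zero]; exact one_pos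
  · obtain ⟨l, hl, hle⟩ := IsUltrametricDist.exists_norm_finsetSum_le_of_nonempty hne
      (fun x => algebraMap k (PadicAlgCl p) (P.coeff x) * t ^ x)
    refine hle.trans_lt ?_
    have hld := Finset.mem_range.mp (Finset.mem_of_mem_erase hl)
    by_cases hl0 : P.coeff l = 0
    · rw [hl0, map_zero, zero_mul, norm_zero]; exact one_pos
    · refine lt_of_le_of_ne (hterm hld) ?_
      have := norm_pow_mul_ne hπ ht hl0 one_ne_zero hld hd0 (Finset.ne_of_mem_erase hl)
      simpa using this

end Ramified

end Tower

section Torsion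

open Polynomial

variable {p : ℕ} [Fact p.Prime] {k : IntermediateField ℚ_[p] (PadicAlgCl p)}

namespace LubinTateDatum

variable {D : LubinTateDatum k}

/-- A generator of the Tate module: a sequence of points with `[π] t (n + 1) = t n` and `t 1 ≠ 0`.
-/
structure IsTower [FiniteDimensional ℚ_[p] k] (t : ℕ → D.Point) : Prop where
  zero : t 0 = 0
  smul_succ : ∀ n, D.π • t (n + 1) = t n
  one_ne_zero : t 1 ≠ 0

/-- The polynomial of degree `(q - 1) q ^ n` whose roots are the points of exact order
`π ^ (n + 1)`. -/
def torsionPoly (D : LubinTateDatum k) : ℕ → k[X]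
  | 0 => X ^ (Nat.card (ResField p k) - 1) + C (D.π : k)
  | n + 1 => (torsionPoly D n).comp (X ^ Nat.card (ResField p k) + C (D.π : k) * X)

variable [FiniteDimensional ℚ_[p] k]

lemma natDegree_basicPoly (D : LubinTateDatum k) :
    (X ^ Nat.card (ResField p k) + C (D.π : k) * X : k[X]).natDegree = Nat.card (ResField p k) ∧
    (X ^ Nat.card (ResField p k) + C (D.π : k) * X : k[X]).Monic := by
  have hq := one_lt_natCard_resField p k
  have hdeg : (C (D.π : k) * X).degree < (Nat.card (ResField p k) : WithBot ℕ) :=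
    (degree_C_mul_X_le _).trans_lt (by exact_mod_cast hq)
  exact ⟨by rw [natDegree_add_eq_left_of_degree_lt (by rwa [degree_X_pow]), natDegree_X_pow],
    monic_X_pow_add hdeg⟩

lemma natDegree_torsionPoly (n : ℕ) : (torsionPoly D n).natDegree =
      (Nat.card (ResField p k) - 1) * Nat.card (ResField p k) ^ n ∧ (torsionPoly D n).Monic := by
  have hq := one_lt_natCard_resField p k
  induction n with
  | zero =>
    refine ⟨?_, monic_X_pow_add_C _ (by omega)⟩
    rw [torsionPoly, natDegree_X_pow_add_C, pow_zero, mul_one]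
  | succ n ih =>
    obtain ⟨h1, h2⟩ := natDegree_basicPoly D
    refine ⟨?_, ih.2.comp h2 (by omega)⟩
    rw [torsionPoly, natDegree_comp, h1, ih.1, pow_succ, mul_assoc]

variable (hD : D.φ = basicSeries D.π)
  (hπ : IsLocalRing.maximalIdeal (IntRing p k) = Ideal.span {D.π})

include hD

lemma pi_smul_val_basic (x : D.Point) : (D.π • x).val =
    x.val ^ Nat.card (ResField p k) + algebraMap k (PadicAlgCl p) D.π * x.val := by
  rw [pi_smul_val, hD, evalSeries_basicSeries]

lemma aeval_torsionPoly (n : ℕ) (x : D.Point) (h0 : D.π ^ n • x ≠ 0)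
    (h1 : D.π ^ (n + 1) • x = 0) : aeval x.val (torsionPoly D n) = 0 := by
  have hq := one_lt_natCard_resField p k
  induction n generalizing x with
  | zero =>
    have h := congrArg Point.val h1
    rw [zero_add, pow_one, pi_smul_val_basic hD, zero_val] at h
    have hx : x.val ≠ 0 := fun hx => h0 (by rw [pow_zero, one_smul]; exact Point.ext hx)
    rw [torsionPoly, map_add, aeval_X_pow, aeval_C]
    apply mul_right_cancel₀ hx
    rw [zero_mul, ← h, add_mul, ← pow_succ, Nat.sub_add_cancel hq.le]
  | succ n ih =>
    have h := ih (D.π • x) (by rwa [← mul_smul, ← pow_succ]) (by rwa [← mul_smul, ← pow_succ])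
    rw [torsionPoly, aeval_comp]
    rw [pi_smul_val_basic hD] at h
    simpa using h

include hπ

/-- The map `[π]` is surjective on points. -/
lemma exists_pi_smul_eq (y : D.Point) : ∃ x : D.Point, D.π • x = y := by
  have hq := one_lt_natCard_resField p k
  have hdeg : (C (algebraMap k (PadicAlgCl p) D.π) * X - C y.val).degree <
      (Nat.card (ResField p k) : WithBot ℕ) := by
    refine (degree_sub_le _ _).trans_lt (max_lt ?_ ?_)
    · exact (degree_C_mul_X_le _).trans_lt (by exact_mod_cast hq)
    · exact degree_C_le.trans_lt (by exact_mod_cast (by omega : 0 < Nat.card (ResField p k)))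
  have hmonic := monic_X_pow_add hdeg
  obtain ⟨x, hx⟩ := IsAlgClosed.exists_root
    (X ^ Nat.card (ResField p k) + (C (algebraMap k (PadicAlgCl p) D.π) * X - C y.val)) (by
      rw [degree_add_eq_left_of_degree_lt (by rwa [degree_X_pow]), degree_X_pow]
      exact_mod_cast (by omega : Nat.card (ResField p k) ≠ 0))
  have hx' : x ^ Nat.card (ResField p k) + algebraMap k (PadicAlgCl p) D.π * x = y.val := by
    rw [IsRoot] at hx
    simp only [eval_add, eval_sub, eval_pow, eval_X, eval_mul, eval_C] at hx
    linear_combination hx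
  have hnorm : ‖x‖ < 1 := by
    by_contra! h
    have hpow : 1 ≤ ‖x ^ Nat.card (ResField p k)‖ := by
      rw [norm_pow]; exact one_le_pow₀ h
    have h2 : ‖algebraMap k (PadicAlgCl p) D.π * x‖ < ‖x ^ Nat.card (ResField p k)‖ := by
      rw [norm_mul, norm_pow]
      calc ‖algebraMap k (PadicAlgCl p) D.π‖ * ‖x‖ < 1 * ‖x‖ :=
            mul_lt_mul_of_pos_right (norm_pi_lt_one hπ) (by linarith)
        _ = ‖x‖ ^ 1 := by rw [one_mul, pow_one]
        _ ≤ _ := pow_le_pow_right₀ h hq.le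
    have h3 := IsUltrametricDist.norm_add_eq_max_of_norm_ne_norm h2.ne'
    rw [hx', max_eq_left h2.le] at h3
    exact absurd y.norm_lt (not_lt.mpr (h3 ▸ hpow))
  refine ⟨⟨x, hnorm⟩, Point.ext ?_⟩
  rw [pi_smul_val_basic hD]
  exact hx'

lemma exists_isTower : ∃ t : ℕ → D.Point, IsTower t := by
  have hq := one_lt_natCard_resField p k
  have hπ0 := norm_pi_pos hπ
  obtain ⟨x, hx⟩ := IsAlgClosed.exists_pow_nat_eq (-algebraMap k (PadicAlgCl p) D.π)
    (show 0 < Nat.card (ResField p k) - 1 by omega)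
  have hxn : ‖x‖ ^ (Nat.card (ResField p k) - 1) = ‖algebraMap k (PadicAlgCl p) D.π‖ := by
    rw [← norm_pow, hx, norm_neg]
  have hx1 : ‖x‖ < 1 := by
    by_contra! h
    exact absurd (norm_pi_lt_one hπ) (not_lt.mpr (hxn ▸ one_le_pow₀ h))
  have hx0 : x ≠ 0 := by
    rintro rfl
    rw [norm_zero, zero_pow (by omega)] at hxn
    exact hπ0.ne hxn
  choose r hr using exists_pi_smul_eq hD hπ
  let t : ℕ → D.Point := fun n => match n with
    | 0 => 0
    | n + 1 => r^[n] ⟨x, hx1⟩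
  refine ⟨t, rfl, fun n => ?_, fun h => hx0 (congrArg Point.val h)⟩
  match n with
  | 0 =>
    apply Point.ext
    rw [pi_smul_val_basic hD]
    change x ^ Nat.card (ResField p k) + algebraMap k (PadicAlgCl p) D.π * x = 0
    obtain ⟨m, hm⟩ : ∃ m, Nat.card (ResField p k) = m + 1 := ⟨_, (Nat.sub_add_cancel hq.le).symm⟩
    rw [hm] at hx ⊢
    rw [Nat.add_sub_cancel] at hx
    rw [pow_succ, hx]
    ring
  | n + 1 =>
    change D.π • r^[n + 1] _ = r^[n] _
    rw [Function.iterate_succ_apply', hr]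

section

variable {t : ℕ → D.Point} (ht : IsTower t)

include ht

omit hD hπ in
lemma IsTower.pi_pow_smul (m n : ℕ) : D.π ^ m • t (m + n) = t n := by
  induction m with
  | zero => simp
  | succ m ih => rw [pow_succ, mul_smul, add_right_comm, ht.smul_succ, ih]

omit hD hπ in
lemma IsTower.pi_pow_smul_self (n : ℕ) : D.π ^ n • t n = 0 := by
  rw [← ht.zero]
  exact ht.pi_pow_smul n 0

/-- The absolute value of a point of exact order `π ^ (n + 1)`. -/
lemma IsTower.norm_pow (n : ℕ) :
    ‖(t (n + 1)).val‖ ^ ((Nat.card (ResField p k) - 1) * Nat.card (ResField p k) ^ n) =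
      ‖algebraMap k (PadicAlgCl p) D.π‖ := by
  have hq := one_lt_natCard_resField p k
  induction n with
  | zero =>
    have h := aeval_torsionPoly hD 0 (t 1) (by simpa using ht.one_ne_zero)
      (by simpa using ht.pi_pow_smul_self 1)
    rw [torsionPoly, map_add, aeval_X_pow, aeval_C] at h
    rw [zero_add, pow_zero, mul_one, ← _root_.norm_pow, eq_neg_of_add_eq_zero_left h, norm_neg]
  | succ n ih =>
    set y := (t (n + 1)).val with hy
    set x := (t (n + 2)).val with hx
    have hxy : x ^ Nat.card (ResField p k) + algebraMap k (PadicAlgCl p) D.π * x = y := by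
      rw [hy, ← ht.smul_succ (n + 1), pi_smul_val_basic hD]
    have hπy : ‖algebraMap k (PadicAlgCl p) D.π‖ ≤ ‖y‖ := by
      rw [← ih]
      refine pow_le_of_le_one (norm_nonneg _) (t (n + 1)).norm_lt.le ?_
      exact mul_ne_zero (by omega) (pow_ne_zero _ (by omega))
    have hlt : ‖algebraMap k (PadicAlgCl p) D.π * x‖ < ‖y‖ := by
      rw [norm_mul]
      exact (mul_lt_of_lt_one_right (norm_pi_pos hπ) (t (n + 2)).norm_lt).trans_le hπy
    have hxq : ‖x‖ ^ Nat.card (ResField p k) = ‖y‖ := by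
      rw [← _root_.norm_pow, eq_sub_of_add_eq hxy, sub_eq_add_neg,
        IsUltrametricDist.norm_add_eq_max_of_norm_ne_norm (by rw [norm_neg]; exact hlt.ne'),
        norm_neg, max_eq_left hlt.le]
    rw [pow_succ', mul_left_comm, pow_mul, hxq, ih]

/-- The points of exact order `π ^ (n + 1)` have the absolute value of roots of an Eisenstein
polynomial, hence degree at least that of `torsionPoly D n`, which is therefore irreducible. -/
lemma IsTower.minpoly_eq (n : ℕ) : minpoly k (t (n + 1)).val = torsionPoly D n := by
  have hint : IsIntegral k (t (n + 1)).val := (normal_padicAlgCl p k).isIntegral _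
  have hne : D.π ^ n • t (n + 1) ≠ 0 := by rw [ht.pi_pow_smul]; exact ht.one_ne_zero
  have h0 : (t (n + 1)).val ≠ 0 := by
    intro h
    apply hne
    rw [show t (n + 1) = 0 from Point.ext h, smul_zero]
  refine (eq_of_monic_of_dvd_of_natDegree_le (minpoly.monic hint) (natDegree_torsionPoly n).2
    (minpoly.dvd _ _ ?_) ?_).symm
  · exact aeval_torsionPoly hD n _ hne (ht.pi_pow_smul_self _)
  · rw [(natDegree_torsionPoly n).1]
    exact le_natDegree_minpoly hπ (IsTower.norm_pow hD hπ ht n) hint h0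

omit hD in
lemma IsTower.pi_dvd_of_smul_one_eq_zero {a : IntRing p k} (ha : a • t 1 = 0) : D.π ∣ a := by
  rw [← Ideal.mem_span_singleton, ← hπ, IsLocalRing.mem_maximalIdeal, mem_nonunits_iff]
  rintro ⟨u, rfl⟩
  apply ht.one_ne_zero
  rw [← one_smul (IntRing p k) (t 1), ← u.inv_mul, mul_smul, ha, smul_zero]

/-- The kernel of `[π]` has at most `q` elements, and contains the `q` multiples of `t 1`. -/
lemma IsTower.exists_smul_one_eq {x : D.Point} (hx : D.π • x = 0) :
    ∃ a : IntRing p k, x = a • t 1 := by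
  classical
  have := Fintype.ofFinite (ResField p k)
  set P : (PadicAlgCl p)[X] := (X ^ Nat.card (ResField p k) + C (D.π : k) * X : k[X]).map
    (algebraMap k (PadicAlgCl p)) with hP
  have hP0 : P ≠ 0 := ((natDegree_basicPoly D).2.map _).ne_zero
  have hroot : ∀ y : D.Point, D.π • y = 0 → y.val ∈ P.roots.toFinset := by
    intro y hy
    have h := congrArg Point.val hy
    rw [pi_smul_val_basic hD, zero_val] at h
    rw [Multiset.mem_toFinset, mem_roots hP0, IsRoot, hP, eval_map_algebraMap]
    simpa using h
  choose l hl using IsLocalRing.residue_surjective (R := IntRing p k)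
  have hcard : P.roots.toFinset.card ≤ (Finset.univ : Finset (ResField p k)).card := by
    rw [Finset.card_univ, ← Nat.card_eq_fintype_card]
    refine (Multiset.toFinset_card_le _).trans ((card_roots' P).trans ?_)
    rw [hP, (natDegree_basicPoly D).2.natDegree_map, (natDegree_basicPoly D).1]
  obtain ⟨c, -, hc⟩ := Finset.surj_on_of_inj_on_of_card_le
    (s := (Finset.univ : Finset (ResField p k))) (t := P.roots.toFinset)
    (fun c _ => (l c • t 1).val)
    (fun c _ => hroot _ (by rw [smul_comm, ht.smul_succ, ht.zero, smul_zero]))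
    (fun c c' _ _ hcc => by
      have h1 : (l c - l c') • t 1 = 0 := by rw [sub_smul, sub_eq_zero]; exact Point.ext hcc
      have h2 := IsTower.pi_dvd_of_smul_one_eq_zero hπ ht h1
      rw [← Ideal.mem_span_singleton, ← hπ, ← IsLocalRing.residue_eq_zero_iff, map_sub, hl, hl,
        sub_eq_zero] at h2
      exact h2)
    hcard x.val (hroot x hx)
  exact ⟨l c, Point.ext hc⟩

/-- The points killed by `π ^ n` are the multiples of `t n`. -/
lemma IsTower.exists_smul_eq (n : ℕ) {x : D.Point} (hx : D.π ^ n • x = 0) :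
    ∃ a : IntRing p k, x = a • t n := by
  induction n generalizing x with
  | zero => exact ⟨0, by simpa using hx⟩
  | succ n ih =>
    obtain ⟨a, ha⟩ := IsTower.exists_smul_one_eq hD hπ ht (x := D.π ^ n • x)
      (by rw [← mul_smul, ← pow_succ', hx])
    have h1 : D.π ^ n • (x - a • t (n + 1)) = 0 := by
      rw [smul_sub, ha, smul_comm, ht.pi_pow_smul, sub_self]
    obtain ⟨b, hb⟩ := ih h1
    refine ⟨b * D.π + a, ?_⟩
    rw [add_smul, mul_smul, ht.smul_succ, ← hb, sub_add_cancel]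

/-- The Galois group permutes the points of exact order `π ^ n` transitively. -/
lemma IsTower.exists_gal_eq (n : ℕ) (u : (IntRing p k)ˣ) :
    ∃ s : PadicAlgCl p ≃ₐ[k] PadicAlgCl p, gal s (t n) = (u : IntRing p k) • t n := by
  rcases n with - | n
  · refine ⟨1, ?_⟩
    rw [ht.zero, smul_zero]
    rfl
  · have := normal_padicAlgCl p k
    have hroot := aeval_torsionPoly hD n ((u : IntRing p k) • t (n + 1))
      (by
        rw [smul_comm, ht.pi_pow_smul]
        intro h
        apply ht.one_ne_zero
        rw [← one_smul (IntRing p k) (t 1), ← u.inv_mul, mul_smul, h, smul_zero])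
      (by rw [smul_comm, ht.pi_pow_smul_self, smul_zero])
    rw [← IsTower.minpoly_eq hD hπ ht] at hroot
    obtain ⟨s, hs⟩ := minpoly.exists_algEquiv_of_root' (this.isAlgebraic _) hroot
    exact ⟨s, Point.ext hs⟩

end

end LubinTateDatum

end Torsion

/-! ### The Lubin–Tate character -/

section Congruence

variable {p : ℕ} [Fact p.Prime]

lemma norm_sub_lt_one_trans {a b c : PadicAlgCl p} (h : ‖a - b‖ < 1) (h' : ‖b - c‖ < 1) :
    ‖a - c‖ < 1 := by
  rw [← sub_add_sub_cancel a b c]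
  exact (IsUltrametricDist.norm_add_le_max _ _).trans_lt (max_lt h h')

lemma norm_pow_sub_pow_lt_one {a b : PadicAlgCl p} (ha : ‖a‖ ≤ 1) (hb : ‖b‖ ≤ 1)
    (h : ‖a - b‖ < 1) (n : ℕ) : ‖a ^ n - b ^ n‖ < 1 := by
  induction n with
  | zero => simp
  | succ n ih =>
    have h1 : ‖a ^ n‖ ≤ 1 := by rw [norm_pow]; exact pow_le_one₀ (norm_nonneg _) ha
    have h2 : ‖a ^ n * (a - b)‖ < 1 := by
      rw [norm_mul]; exact mul_lt_one_of_nonneg_of_lt_one_right h1 (norm_nonneg _) h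
    have h3 : ‖(a ^ n - b ^ n) * b‖ < 1 := by
      rw [norm_mul]; exact mul_lt_one_of_nonneg_of_lt_one_left (norm_nonneg _) ih hb
    rw [show a ^ (n + 1) - b ^ (n + 1) = a ^ n * (a - b) + (a ^ n - b ^ n) * b by ring]
    exact (IsUltrametricDist.norm_add_le_max _ _).trans_lt (max_lt h2 h3)

end Congruence

section Character

open Polynomial

variable {p : ℕ} [Fact p.Prime] {k : IntermediateField ℚ_[p] (PadicAlgCl p)}

lemma isGalois_padicAlgCl (p : ℕ) [Fact p.Prime] (k : IntermediateField ℚ_[p] (PadicAlgCl p)) :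
    IsGalois k (PadicAlgCl p) := by
  have := normal_padicAlgCl p k
  exact ⟨⟩

lemma isClosed_setOf_algEquiv_apply_eq (x y : PadicAlgCl p) :
    IsClosed {s : Gal(PadicAlgCl p/k) | s x = y} := by
  rcases Set.eq_empty_or_nonempty {s : Gal(PadicAlgCl p/k) | s x = y} with h | ⟨s₀, hs₀⟩
  · rw [h]; exact isClosed_empty
  have hfin : FiniteDimensional k (IntermediateField.adjoin k {x}) :=
    IntermediateField.adjoin.finiteDimensional ((normal_padicAlgCl p k).isIntegral x)
  have h1 := (IntermediateField.fixingSubgroup_isClosed (IntermediateField.adjoin k {x})).preimage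
    (continuous_const_mul s₀⁻¹)
  convert h1 using 1
  ext s
  have hs₀' : s₀ x = y := hs₀
  simp only [Set.mem_ofPred_eq, Set.mem_preimage, SetLike.mem_coe,
    IntermediateField.mem_fixingSubgroup_iff]
  constructor
  · intro hs
    have hle : IntermediateField.adjoin k {x} ≤
        IntermediateField.fixedField (Subgroup.zpowers (s₀⁻¹ * s)) := by
      rw [IntermediateField.adjoin_simple_le_iff]
      rintro ⟨g, hg⟩
      have hfix : s₀⁻¹ * s ∈ MulAction.stabilizer Gal(PadicAlgCl p/k) x := by
        rw [MulAction.mem_stabilizer_iff]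
        change s₀.symm (s x) = x
        rw [hs, ← hs₀', AlgEquiv.symm_apply_apply]
      exact (Subgroup.zpowers_le.mpr hfix) hg
    exact fun z hz => hle hz ⟨_, Subgroup.mem_zpowers _⟩
  · intro h
    have := h x (IntermediateField.mem_adjoin_simple_self k x)
    change s₀.symm (s x) = x at this
    rw [← hs₀', ← this, AlgEquiv.apply_symm_apply, this]

namespace LubinTateDatum

variable [FiniteDimensional ℚ_[p] k] {D : LubinTateDatum k}

lemma mem_torsion_iff {n : ℕ} {x : PadicAlgCl p} :
    x ∈ torsion D.φ n ↔ ∃ y : D.Point, y.val = x ∧ D.π ^ n • y = 0 := by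
  constructor
  · rintro ⟨hx, h⟩
    exact ⟨⟨x, hx⟩, rfl, Point.ext (by rw [pi_pow_smul_val]; exact h)⟩
  · rintro ⟨y, rfl, hy⟩
    refine ⟨y.norm_lt, ?_⟩
    rw [← pi_pow_smul_val, hy, zero_val]

lemma mem_tateModule_iff {s : ℕ → PadicAlgCl p} :
    s ∈ tateModule D.φ ↔
      ∃ y : ℕ → D.Point, (∀ n, (y n).val = s n) ∧ y 0 = 0 ∧ ∀ n, D.π • y (n + 1) = y n := by
  constructor
  · intro hs
    refine ⟨fun n => ⟨s n, (hs n).1.1⟩, fun n => rfl, Point.ext (hs 0).1.2, fun n => Point.ext ?_⟩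
    rw [pi_smul_val]
    exact (hs n).2
  · rintro ⟨y, hy, hy0, hyπ⟩ n
    have hpow : ∀ n, D.π ^ n • y n = 0 := by
      intro n
      induction n with
      | zero => simpa using hy0
      | succ n ih => rw [pow_succ, mul_smul, hyπ, ih]
    refine ⟨mem_torsion_iff.mpr ⟨y n, hy n, hpow n⟩, ?_⟩
    rw [← hy n, ← hy (n + 1), ← hyπ n, pi_smul_val]

/-- `χ_π(s) = u` if and only if `s` acts as multiplication by `u` on the compatible systems of
torsion points. -/
lemma lubinTateCharEq_iff_tate (s : PadicAlgCl p ≃ₐ[k] PadicAlgCl p) (u : (IntRing p k)ˣ) :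
    LubinTateCharEq D.φ s u ↔ ∀ y : ℕ → D.Point, y 0 = 0 → (∀ n, D.π • y (n + 1) = y n) →
      ∀ n, gal s (y n) = (u : IntRing p k) • y n := by
  constructor
  · rintro ⟨g, hg, h⟩ y hy0 hyπ n
    have := h _ (mem_tateModule_iff.mpr ⟨y, fun _ => rfl, hy0, hyπ⟩) n
    exact Point.ext (this.trans (smul_val_of_isFormalHom ((isFormalMul_iff _ _).mp hg) _).symm)
  · intro h
    obtain ⟨g, hg⟩ := exists_isFormalMul (D := D) (u : IntRing p k)
    refine ⟨g, hg, fun s' hs' n => ?_⟩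
    obtain ⟨y, hy, hy0, hyπ⟩ := mem_tateModule_iff.mp hs'
    rw [← hy, ← smul_val_of_isFormalHom ((isFormalMul_iff _ _).mp hg), ← h y hy0 hyπ, gal_val]

section

variable (hD : D.φ = basicSeries D.π)
  (hπ : IsLocalRing.maximalIdeal (IntRing p k) = Ideal.span {D.π})
  {t : ℕ → D.Point} (ht : IsTower t)

include hD hπ ht

/-- `χ_π(s)` is determined by the action of `s` on a generator of the Tate module. -/
lemma IsTower.lubinTateCharEq_iff (s : PadicAlgCl p ≃ₐ[k] PadicAlgCl p) (u : (IntRing p k)ˣ) :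
    LubinTateCharEq D.φ s u ↔ ∀ n, gal s (t n) = (u : IntRing p k) • t n := by
  rw [lubinTateCharEq_iff_tate]
  constructor
  · exact fun h => h t ht.zero ht.smul_succ
  · intro h y hy0 hyπ n
    have hpow : D.π ^ n • y n = 0 := by
      induction n with
      | zero => simpa using hy0
      | succ n ih => rw [pow_succ, mul_smul, hyπ, ih]
    obtain ⟨a, ha⟩ := IsTower.exists_smul_eq hD hπ ht n hpow
    rw [ha, gal_smul, h, smul_comm]

/-- The Lubin–Tate character is surjective: it is so at each finite level, and the absolute Galois
group is compact. -/
lemma IsTower.exists_lubinTateCharEq (u : (IntRing p k)ˣ) :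
    ∃ s : PadicAlgCl p ≃ₐ[k] PadicAlgCl p, LubinTateCharEq D.φ s u := by
  have := isGalois_padicAlgCl p k
  let C : ℕ → Set Gal(PadicAlgCl p/k) := fun n => {s | gal s (t n) = (u : IntRing p k) • t n}
  have hC : ∀ n, C n =
      {s : Gal(PadicAlgCl p/k) | s (t n).val = ((u : IntRing p k) • t n).val} := fun n => by
    ext s
    exact ⟨fun h => congrArg Point.val h, fun h => Point.ext h⟩
  have hclosed : ∀ n, IsClosed (C n) := fun n => by
    rw [hC]; exact isClosed_setOf_algEquiv_apply_eq _ _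
  obtain ⟨s, hs⟩ := IsCompact.nonempty_iInter_of_sequence_nonempty_isCompact_isClosed C
    (fun n s hs => by
      change gal s (t n) = _
      rw [← ht.smul_succ, gal_smul, show gal s (t (n + 1)) = _ from hs, smul_comm])
    (fun n => IsTower.exists_gal_eq hD hπ ht n u) (hclosed 0).isCompact hclosed
  rw [Set.mem_iInter] at hs
  exact ⟨s, (IsTower.lubinTateCharEq_iff hD hπ ht s u).mpr hs⟩

lemma IsTower.val_mem_adjoin {n : ℕ} {x : D.Point} (hx : D.π ^ n • x = 0) :
    x.val ∈ IntermediateField.adjoin k {(t n).val} := by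
  obtain ⟨a, rfl⟩ := IsTower.exists_smul_eq hD hπ ht n hx
  exact smul_val_mem a (t n) (IntermediateField.adjoin k {(t n).val}).toSubfield
    (fun c => (IntermediateField.adjoin k {(t n).val}).algebraMap_mem c)
    (IntermediateField.mem_adjoin_simple_self k _)

lemma IsTower.exists_mem_adjoin {e : PadicAlgCl p} (he : e ∈ lubinTateExt D.φ) :
    ∃ n, e ∈ IntermediateField.adjoin k {(t (n + 1)).val} := by
  have hmono : Monotone fun n => IntermediateField.adjoin k {(t (n + 1)).val} := by
    refine monotone_nat_of_le_succ fun n => ?_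
    rw [IntermediateField.adjoin_simple_le_iff]
    refine IsTower.val_mem_adjoin hD hπ ht ?_
    rw [pow_succ', mul_smul, ht.pi_pow_smul_self, smul_zero]
  have hle : lubinTateExt D.φ ≤ ⨆ n, IntermediateField.adjoin k {(t (n + 1)).val} := by
    refine IntermediateField.adjoin_le_iff.mpr ?_
    rintro x hx
    obtain ⟨n, hx⟩ := Set.mem_iUnion.mp hx
    obtain ⟨y, rfl, hy⟩ := mem_torsion_iff.mp hx
    refine le_iSup (fun n => IntermediateField.adjoin k {(t (n + 1)).val}) n
      (IsTower.val_mem_adjoin hD hπ ht ?_)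
    rw [pow_succ', mul_smul, hy, smul_zero]
  have h := hle he
  rw [← SetLike.mem_coe, IntermediateField.coe_iSup_of_directed hmono.directed_le,
    Set.mem_iUnion] at h
  exact h

/-- The Lubin–Tate extension is totally ramified: its residue field is that of `k`. -/
lemma IsTower.frobeniusFixed_lubinTateExt :
    FrobeniusFixed p (lubinTateExt D.φ) (Nat.card (ResField p k)) := by
  rw [frobeniusFixed_iff]
  intro e he
  obtain ⟨n, hn⟩ := IsTower.exists_mem_adjoin hD hπ ht e.2
  have hint : IsIntegral k (t (n + 1)).val := (normal_padicAlgCl p k).isIntegral _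
  obtain ⟨c, hc1, hc⟩ := exists_norm_sub_lt_one hπ (IsTower.norm_pow hD hπ ht n) hint
    (by rw [IsTower.minpoly_eq hD hπ ht, (natDegree_torsionPoly n).1]) hn he
  have h1 := frobeniusFixed_iff.mp (frobeniusFixed_natCard (p := p) k) c hc1
  exact norm_sub_lt_one_trans (norm_sub_lt_one_trans (norm_pow_sub_pow_lt_one he hc1 hc _) h1)
    (by rwa [norm_sub_rev])

end

end LubinTateDatum

/-- The ring homomorphism from the `p`-adic integers to the ring of integers of `k`. -/
def padicIntToIntRing (k : IntermediateField ℚ_[p] (PadicAlgCl p)) : ℤ_[p] →+* IntRing p k :=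
  ((algebraMap ℚ_[p] k).comp (PadicInt.subring p).subtype).codRestrict (IntRing p k).toSubring
    fun z => by
      rw [ValuationSubring.mem_toSubring, mem_intRing_iff]
      change ‖algebraMap ℚ_[p] (PadicAlgCl p) (z : ℚ_[p])‖ ≤ 1
      rw [norm_algebraMap']
      exact z.2

/-- By Hensel's lemma `1 + p ^ t` is an `M`-th power in `ℤ_[p]` for some `t`. -/
lemma exists_pow_eq_one_add_p_pow {M : ℕ} (hM : M ≠ 0) :
    ∃ t : ℕ, ∃ z : ℤ_[p]ˣ, (z : ℤ_[p]) ^ M = 1 + (p : ℤ_[p]) ^ t := by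
  have hp : 1 < p := (Fact.out : p.Prime).one_lt
  have hMnorm : 0 < ‖(M : ℤ_[p])‖ ^ 2 := by
    have : (M : ℤ_[p]) ≠ 0 := by exact_mod_cast hM
    positivity
  have hpn : ‖(p : ℤ_[p])‖ < 1 := by
    rw [PadicInt.norm_p]
    exact inv_lt_one_of_one_lt₀ (by exact_mod_cast hp)
  obtain ⟨t, ht⟩ := exists_pow_lt_of_lt_one hMnorm hpn
  set F : ℤ_[p][X] := X ^ M - C (1 + (p : ℤ_[p]) ^ (t + 1)) with hF
  have hFeval : ∀ z, aeval z F = z ^ M - (1 + (p : ℤ_[p]) ^ (t + 1)) := fun z => by simp [hF]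
  have hFder : aeval (1 : ℤ_[p]) (derivative F) = (M : ℤ_[p]) := by
    rw [hF, derivative_sub, derivative_C, sub_zero, derivative_X_pow]
    simp
  obtain ⟨z, hz, -⟩ := hensels_lemma (F := F) (a := 1) (by
    rw [hFeval, hFder, one_pow, sub_add_cancel_left, norm_neg, norm_pow]
    exact (pow_le_pow_of_le_one (norm_nonneg _) hpn.le (Nat.le_succ t)).trans_lt ht)
  rw [hFeval, sub_eq_zero] at hz
  have hunit : IsUnit (1 + (p : ℤ_[p]) ^ (t + 1)) := by
    by_contra h
    have h1 := (IsLocalRing.mem_maximalIdeal _).mpr (mem_nonunits_iff.mpr h)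
    have h2 : (p : ℤ_[p]) ^ (t + 1) ∈ IsLocalRing.maximalIdeal ℤ_[p] := by
      refine Ideal.pow_mem_of_mem _ ?_ _ (Nat.succ_pos t)
      rw [IsLocalRing.mem_maximalIdeal, PadicInt.mem_nonunits]
      exact hpn
    have h3 := sub_mem h1 h2
    rw [add_sub_cancel_right] at h3
    exact (Ideal.ne_top_iff_one _).mp (IsLocalRing.maximalIdeal.isMaximal ℤ_[p]).ne_top h3
  have hzu : IsUnit z := by
    rw [← hz] at hunit
    exact (isUnit_pow_iff hM).mp hunit
  exact ⟨t + 1, hzu.unit, hz⟩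

namespace LubinTateDatum

variable [FiniteDimensional ℚ_[p] k] {D : LubinTateDatum k}

/-- The image of `G_K` under the Lubin–Tate character contains `1 + p ^ t` for some `t`, since its
index in the image of `G_k` is finite. -/
lemma exists_one_add_p_pow_mem (hD : D.φ = basicSeries D.π)
    (hπ : IsLocalRing.maximalIdeal (IntRing p k) = Ideal.span {D.π})
    (K : IntermediateField k (PadicAlgCl p)) [FiniteDimensional k K] :
    ∃ t : ℕ, ∃ u ∈ lubinTateCharImage D.φ K,
      (u : IntRing p k) = 1 + (p : IntRing p k) ^ t := by
  have := isGalois_padicAlgCl p k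
  obtain ⟨τ, hτ⟩ := exists_isTower hD hπ
  have hindex : K.fixingSubgroup.index ≠ 0 := by
    rw [← IntermediateField.finrank_eq_fixingSubgroup_index]
    exact Module.finrank_pos.ne'
  obtain ⟨t, z, hz⟩ := exists_pow_eq_one_add_p_pow (p := p)
    (Nat.factorial_ne_zero K.fixingSubgroup.index)
  obtain ⟨s, hs⟩ := IsTower.exists_lubinTateCharEq hD hπ hτ
    (Units.map (padicIntToIntRing k).toMonoidHom z)
  have hs' := (IsTower.lubinTateCharEq_iff hD hπ hτ s _).mp hs
  -- Some power `s ^ n` with `n` at most the index lies in `G_K`, and `n` divides the factorial.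
  obtain ⟨n, hn0, hn, hmem⟩ := Subgroup.exists_pow_mem_of_index_ne_zero hindex s
  obtain ⟨m, hm⟩ := Nat.dvd_factorial hn0 hn
  have hpow : ∀ j i, gal (s ^ j) (τ i) =
      (((Units.map (padicIntToIntRing k).toMonoidHom z) ^ j : (IntRing p k)ˣ) : IntRing p k) •
        τ i := by
    intro j i
    induction j with
    | zero => simp only [pow_zero, Units.val_one, one_smul]; rfl
    | succ j ih =>
      rw [pow_succ', gal_mul, ih, gal_smul, hs', ← mul_smul, pow_succ, Units.val_mul]
  refine ⟨t, (Units.map (padicIntToIntRing k).toMonoidHom z) ^ K.fixingSubgroup.index.factorial,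
    ⟨s ^ K.fixingSubgroup.index.factorial, ?_,
      (IsTower.lubinTateCharEq_iff hD hπ hτ _ _).mpr (hpow _)⟩, ?_⟩
  · rw [hm, pow_mul]
    exact pow_mem hmem m
  · have := congrArg (padicIntToIntRing k) hz
    rw [map_pow, map_add, map_one, map_pow, map_natCast] at this
    exact this

end LubinTateDatum

end Character

/-! ### The Galois action on residues -/

section ResidueAction

variable {p : ℕ} [Fact p.Prime] {k : IntermediateField ℚ_[p] (PadicAlgCl p)}

lemma exists_norm_pow_sub_one_lt_one {b : PadicAlgCl p} (hb : ‖b‖ = 1) :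
    ∃ n ≠ 0, ‖b ^ n - 1‖ < 1 := by
  have hp : 1 < p := (Fact.out : p.Prime).one_lt
  set N := (minpoly ℚ_[p] b).natDegree
  have h := norm_pow_sub_lt_one_of_natDegree_le (E := ℚ_[p]) (f := 1) (pow_one p).symm
    frobeniusFixed_padic hb.le le_rfl
  have h1 : 1 < p ^ N.factorial := Nat.one_lt_pow (Nat.factorial_ne_zero _) hp
  refine ⟨p ^ N.factorial - 1, by omega, ?_⟩
  have h2 : b ^ p ^ N.factorial - b = b * (b ^ (p ^ N.factorial - 1) - 1) := by
    rw [mul_sub, mul_one, ← pow_succ', Nat.sub_add_cancel h1.le]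
  rwa [h2, norm_mul, hb, one_mul] at h

/-- An automorphism acts on the residue of a unit by raising it to a power, since it permutes the
roots of unity of the residue field. -/
lemma exists_norm_algEquiv_sub_pow_lt_one (s : PadicAlgCl p ≃ₐ[k] PadicAlgCl p)
    {b : PadicAlgCl p} (hb : ‖b‖ = 1) : ∃ i : ℕ, ‖s b - b ^ i‖ < 1 := by
  have hb' : b ∈ IntRing p (PadicAlgCl p) := mem_intRing_padicAlgCl_iff.mpr hb.le
  have hs' : s b ∈ IntRing p (PadicAlgCl p) :=
    mem_intRing_padicAlgCl_iff.mpr (by rw [norm_algEquiv, hb])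
  set x := IsLocalRing.residue (IntRing p (PadicAlgCl p)) ⟨b, hb'⟩ with hx
  set y := IsLocalRing.residue (IntRing p (PadicAlgCl p)) ⟨s b, hs'⟩ with hy
  have hxy : ∀ n, x ^ n = 1 → y ^ n = 1 := by
    intro n hn
    rw [hx, ← map_pow, ← map_one (IsLocalRing.residue _), residue_padicAlgCl_eq_iff] at hn
    rw [hy, ← map_pow, ← map_one (IsLocalRing.residue _), residue_padicAlgCl_eq_iff]
    have h := norm_algEquiv s (b ^ n - 1)
    rw [map_sub, map_pow, map_one] at h
    change ‖(s b) ^ n - 1‖ < 1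
    rw [h]
    exact hn
  obtain ⟨n, hn0, hn⟩ := exists_norm_pow_sub_one_lt_one hb
  have hxn : x ^ n = 1 := by
    rw [hx, ← map_pow, ← map_one (IsLocalRing.residue _), residue_padicAlgCl_eq_iff]
    exact hn
  have hord : orderOf x ≠ 0 := fun h =>
    hn0 (by simpa [h] using orderOf_dvd_of_pow_eq_one hxn)
  have : NeZero (orderOf x) := ⟨hord⟩
  obtain ⟨i, -, hi⟩ := (IsPrimitiveRoot.orderOf x).eq_pow_of_pow_eq_one
    (hxy _ (pow_orderOf_eq_one x))
  refine ⟨i, ?_⟩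
  rw [hx, hy, ← map_pow, residue_padicAlgCl_eq_iff, norm_sub_rev] at hi
  exact hi

/-- Automorphisms of `PadicAlgCl p` commute on the residue field. -/
lemma norm_algEquiv_comm_lt_one (s h : PadicAlgCl p ≃ₐ[k] PadicAlgCl p) {b : PadicAlgCl p}
    (hb : ‖b‖ ≤ 1) : ‖s (h b) - h (s b)‖ < 1 := by
  rcases hb.lt_or_eq with hb | hb
  · rw [sub_eq_add_neg]
    refine (IsUltrametricDist.norm_add_le_max _ _).trans_lt (max_lt ?_ ?_)
    · rwa [norm_algEquiv, norm_algEquiv]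
    · rwa [norm_neg, norm_algEquiv, norm_algEquiv]
  · have key : ∀ s h : PadicAlgCl p ≃ₐ[k] PadicAlgCl p, ∀ i j : ℕ, ‖s b - b ^ i‖ < 1 →
        ‖h b - b ^ j‖ < 1 → ‖s (h b) - b ^ (i * j)‖ < 1 := by
      intro s h i j hi hj
      have h1 : ‖s (h b) - s b ^ j‖ < 1 := by
        rwa [← map_pow, ← map_sub, norm_algEquiv]
      refine norm_sub_lt_one_trans h1 ?_
      rw [pow_mul]
      refine norm_pow_sub_pow_lt_one ?_ ?_ hi j
      · rw [norm_algEquiv, hb]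
      · rw [norm_pow, hb, one_pow]
    obtain ⟨i, hi⟩ := exists_norm_algEquiv_sub_pow_lt_one s hb
    obtain ⟨j, hj⟩ := exists_norm_algEquiv_sub_pow_lt_one h hb
    refine norm_sub_lt_one_trans (key s h i j hi hj) ?_
    rw [norm_sub_rev, mul_comm]
    exact key h s j i hj hi

lemma norm_pow_apply_sub_lt_one (h : PadicAlgCl p ≃ₐ[k] PadicAlgCl p) {b : PadicAlgCl p}
    (hb : ‖b‖ ≤ 1) {Q : ℕ} (hQ : ‖h b - b ^ Q‖ < 1) (j : ℕ) :
    ‖(h ^ j) b - b ^ Q ^ j‖ < 1 := by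
  induction j with
  | zero => simp
  | succ j ih =>
    rw [pow_succ, pow_succ, pow_mul]
    change ‖(h ^ j) (h b) - _‖ < 1
    have h1 : ‖(h ^ j) (h b) - ((h ^ j) b) ^ Q‖ < 1 := by
      rwa [← map_pow, ← map_sub, norm_algEquiv]
    refine norm_sub_lt_one_trans h1 (norm_pow_sub_pow_lt_one ?_ ?_ ih Q)
    · rwa [norm_algEquiv]
    · rw [norm_pow]; exact pow_le_one₀ (norm_nonneg _) hb

end ResidueAction

/-! ### Kummer theory -/

section Kummer

variable {p : ℕ} [Fact p.Prime] {k : IntermediateField ℚ_[p] (PadicAlgCl p)}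
  [FiniteDimensional ℚ_[p] k] {D : LubinTateDatum k} {K : IntermediateField k (PadicAlgCl p)}

namespace LubinTateDatum

/-- If `σ` acts on the torsion points as multiplication by `m`, and `h` fixes them, then
`σ h σ⁻¹ = h ^ m` on the field `K̃`: the Kummer cocycle of `h` at a point `x` is a torsion point `τ`,
and `σ h σ⁻¹` translates `x` by `σ τ = m τ`. -/
lemma conj_apply_eq_pow_apply {s h : PadicAlgCl p ≃ₐ[k] PadicAlgCl p} {m : ℕ}
    (hsK : ∀ x ∈ K, s x = x) (hhK : ∀ x ∈ K, h x = x)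
    (hs : ∀ (n : ℕ) (x : D.Point), D.π ^ n • x = 0 → gal s x = (m : IntRing p k) • x)
    (hh : ∀ (n : ℕ) (x : D.Point), D.π ^ n • x = 0 → gal h x = x)
    {a : PadicAlgCl p} (ha : a ∈ kummerExt D.φ K) : (s * h * s⁻¹) a = (h ^ m) a := by
  have hs'K : ∀ x ∈ K, s⁻¹ x = x := fun x hx => by
    conv_lhs => rw [← hsK x hx]
    exact s.symm_apply_apply x
  have hpowK : ∀ x ∈ K, ∀ j : ℕ, (h ^ j) x = x := by
    intro x hx j
    induction j with
    | zero => rfl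
    | succ j ih => rw [pow_succ]; exact (congrArg _ (hhK x hx)).trans ih
  have hgen : ∀ (n : ℕ) (x : D.Point), (D.π ^ n • x).val ∈ K →
      gal (s * h * s⁻¹) x = gal (h ^ m) x := by
    intro n x hx
    have htors : ∀ g : PadicAlgCl p ≃ₐ[k] PadicAlgCl p, (∀ x ∈ K, g x = x) →
        D.π ^ n • (gal g x - x) = 0 := by
      intro g hg
      rw [smul_sub, ← gal_smul, sub_eq_zero]
      exact Point.ext (hg _ hx)
    set τ := gal h x - x with hτ
    set ρ := gal s⁻¹ x - x with hρ
    have hτ0 := htors h hhK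
    have hρ0 := htors s⁻¹ hs'K
    have hpow : ∀ j : ℕ, gal (h ^ j) x = x + (j : IntRing p k) • τ := by
      intro j
      induction j with
      | zero => simp only [pow_zero, Nat.cast_zero, zero_smul, add_zero]; rfl
      | succ j ih =>
        rw [pow_succ', gal_mul, ih, gal_add, gal_smul, hh n τ hτ0, Nat.cast_succ, add_smul,
          one_smul, hτ]
        abel
    have h1 : gal s⁻¹ x = x + ρ := by rw [hρ]; abel
    have h2 : gal s (gal s⁻¹ x) = x := Point.ext (s.apply_symm_apply x.val)
    rw [hpow, gal_mul, gal_mul, h1, gal_add, hh n ρ hρ0, show gal h x = x + τ by rw [hτ]; abel,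
      add_right_comm, ← h1, gal_add, h2, hs n τ hτ0]
  refine IntermediateField.adjoin_induction K (p := fun a _ => (s * h * s⁻¹) a = (h ^ m) a)
    ?_ ?_ ?_ ?_ ?_ ha
  · rintro x ⟨hx, n, -, hn⟩
    refine congrArg Point.val (hgen n ⟨x, hx⟩ ?_)
    rw [pi_pow_smul_val]
    exact hn
  · intro x
    change s (h (s⁻¹ x.1)) = (h ^ m) x.1
    rw [hs'K x.1 x.2, hhK x.1 x.2, hsK x.1 x.2, hpowK x.1 x.2]
  · intro x y _ _ hx hy
    rw [map_add, map_add, hx, hy]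
  · intro x _ hx
    rw [map_inv₀, map_inv₀, hx]
  · intro x y _ _ hx hy
    rw [map_mul, map_mul, hx, hy]

end LubinTateDatum

end Kummer

/-! ### Independence of the Lubin–Tate series -/

section Transport

variable {p : ℕ} [Fact p.Prime] {k : IntermediateField ℚ_[p] (PadicAlgCl p)}
  [FiniteDimensional ℚ_[p] k]

namespace LubinTateDatum

variable {D D' : LubinTateDatum k} (h : D'.π = D.π)

/-- The isomorphism between the points of two Lubin–Tate series for the same uniformizer. -/
def transport (x : D'.Point) : D.Point :=
  mapPt h (fun _ : Unit => 1) fun _ => x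

lemma transport_smul (a : IntRing p k) (x : D'.Point) :
    transport h (a • x) = a • transport h x := by
  rw [transport, transport, mapPt_smul, smul_def, mapPt_mapPt]
  congr 1
  funext i
  simp

lemma transport_transport (x : D'.Point) : transport h.symm (transport h x) = x := by
  have := mapPt_mapPt h.symm h (fun _ : Unit => 1) (fun _ _ => 1) fun _ : Unit => x
  rw [transport, transport, this]
  refine Eq.trans ?_ (mapPt_single D' () fun _ : Unit => x)
  congr 1
  funext i
  simp

lemma gal_transport (s : PadicAlgCl p ≃ₐ[k] PadicAlgCl p) (x : D'.Point) :
    gal s (transport h x) = transport h (gal s x) := gal_mapPt _ _ _ _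

lemma transport_zero : transport h 0 = 0 := by
  rw [← zero_smul (IntRing p k) (0 : D'.Point), transport_smul, zero_smul]

lemma transport_val_mem (x : D'.Point) (M : Subfield (PadicAlgCl p))
    (hM : ∀ a : k, (a : PadicAlgCl p) ∈ M) (hx : x.val ∈ M) : (transport h x).val ∈ M :=
  mapPt_val_mem _ _ _ M hM fun _ => hx

include h

lemma lubinTateExt_le : lubinTateExt D'.φ ≤ lubinTateExt D.φ := by
  refine IntermediateField.adjoin_le_iff.mpr fun x hx => ?_
  obtain ⟨n, hx⟩ := Set.mem_iUnion.mp hx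
  obtain ⟨y, rfl, hy⟩ := mem_torsion_iff.mp hx
  rw [← transport_transport h y]
  refine transport_val_mem h.symm _ (lubinTateExt D.φ).toSubfield
    (fun c => (lubinTateExt D.φ).algebraMap_mem c)
    (IntermediateField.subset_adjoin k _ (Set.mem_iUnion.mpr ⟨n, mem_torsion_iff.mpr
      ⟨_, rfl, ?_⟩⟩))
  rw [← h, ← transport_smul, hy, transport_zero]

lemma kummerExt_le (K : IntermediateField k (PadicAlgCl p)) :
    kummerExt D'.φ K ≤ kummerExt D.φ K := by
  refine IntermediateField.adjoin_le_iff.mpr ?_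
  rintro x ⟨hx, n, hn, hxn⟩
  set y : D'.Point := ⟨x, hx⟩ with hy
  have hyx : y.val = x := rfl
  have hK : ∀ c : k, (c : PadicAlgCl p) ∈ K.toSubfield := fun c => K.algebraMap_mem c
  rw [← hyx, ← transport_transport h y]
  refine transport_val_mem h.symm _ (kummerExt D.φ K).toSubfield
    (fun c => (kummerExt D.φ K).algebraMap_mem ⟨c, hK c⟩)
    (IntermediateField.subset_adjoin K _ ⟨(transport h y).norm_lt, n, hn, ?_⟩)
  rw [← pi_pow_smul_val, ← h, ← transport_smul]
  refine transport_val_mem h _ K.toSubfield hK ?_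
  rw [pi_pow_smul_val]
  exact hxn

lemma lubinTateCharImage_subset (K : IntermediateField k (PadicAlgCl p)) :
    lubinTateCharImage D'.φ K ⊆ lubinTateCharImage D.φ K := by
  rintro u ⟨s, hs, hsu⟩
  refine ⟨s, hs, (lubinTateCharEq_iff_tate s u).mpr fun y hy0 hyπ n => ?_⟩
  have := (lubinTateCharEq_iff_tate s u).mp hsu (fun n => transport h.symm (y n))
    (by rw [hy0, transport_zero]) (fun n => by
      rw [← hyπ n, transport_smul]
      exact congrArg (fun c => c • transport h.symm (y (n + 1))) h) n
  rw [← transport_transport h.symm (y n), gal_transport, this, transport_smul]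

end LubinTateDatum

end Transport

/-! ### The residue field of `K̃` -/

section Main

variable {p : ℕ} [Fact p.Prime] {k : IntermediateField ℚ_[p] (PadicAlgCl p)}
  [FiniteDimensional ℚ_[p] k] {D : LubinTateDatum k}

/-- If the `m`-th power of the Frobenius map of the finite field `F'` is trivial on `F''`, then
`F''` has degree dividing `m` over `F'`. -/
lemma finrank_dvd_mul_finrank (F F' F'' : Type*) [Field F] [Field F'] [Finite F'] [Field F'']
    [Finite F''] [Algebra F F'] [Algebra F' F''] [Algebra F F''] [IsScalarTower F F' F''] {m : ℕ}
    (h : ∀ x : F'', x ^ Nat.card F' ^ m = x) :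
    Module.finrank F F'' ∣ m * Module.finrank F F' := by
  have := Fintype.ofFinite F'
  rw [← Module.finrank_mul_finrank F F' F'', mul_comm]
  refine mul_dvd_mul_right ?_ _
  rw [← FiniteField.orderOf_frobeniusAlgHom F' F'', orderOf_dvd_iff_pow_eq_one]
  ext x
  rw [AlgHom.coe_pow, FiniteField.coe_frobeniusAlgHom, pow_iterate, ← Nat.card_eq_fintype_card]
  exact h x

omit [FiniteDimensional ℚ_[p] k] in
/-- The Frobenius map of a finite residue field lifts to an automorphism fixing the given field. -/
lemma exists_algEquiv_pow_natCard_congr {K : IntermediateField k (PadicAlgCl p)}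
    (L : IntermediateField K (PadicAlgCl p)) [Finite (ResField p L)] {b : PadicAlgCl p}
    (hb : ‖b‖ ≤ 1) : ∃ h : PadicAlgCl p ≃ₐ[k] PadicAlgCl p, (∀ x ∈ L, h x = x) ∧
      ‖h b - b ^ Nat.card (ResField p L)‖ < 1 := by
  obtain ⟨f, -, hf⟩ := exists_natCard_resField (p := p) L
  let : Algebra ℚ_[p] L := ((algebraMap k L).comp (algebraMap ℚ_[p] k)).toAlgebra
  have : IsScalarTower ℚ_[p] L (PadicAlgCl p) := IsScalarTower.of_algebraMap_eq fun _ => rfl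
  obtain ⟨h, hh⟩ := exists_algEquiv_pow_congr hf (frobeniusFixed_natCard L) hb
  exact ⟨AlgEquiv.ofRingEquiv (f := h.toRingEquiv) fun x => h.commutes (algebraMap k L x),
    fun x hx => h.commutes ⟨x, hx⟩, hh⟩

namespace LubinTateDatum

/-- Since `k_π` is totally ramified over `k`, its residue field is finite, and so is that of its
finite extension `K k_π`. -/
lemma finite_resField_compositeLT (hD : D.φ = basicSeries D.π)
    (hπ : IsLocalRing.maximalIdeal (IntRing p k) = Ideal.span {D.π})
    (K : IntermediateField k (PadicAlgCl p)) [FiniteDimensional k K] :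
    Finite (ResField p (compositeLT D.φ K)) := by
  obtain ⟨t, ht⟩ := exists_isTower hD hπ
  obtain ⟨f, -, hf⟩ := exists_natCard_resField (p := p) k
  let E := lubinTateExt D.φ
  have : IsScalarTower ℚ_[p] E (PadicAlgCl p) := IsScalarTower.of_algebraMap_eq fun _ => rfl
  set M := IntermediateField.adjoin E (K : Set (PadicAlgCl p)) with hM
  have hrank : Module.rank E M ≤ Module.rank k K :=
    IntermediateField.adjoin_rank_le_of_isAlgebraic E K (Or.inr inferInstance)
  have hfin : FiniteDimensional E M :=
    Module.rank_lt_aleph0_iff.mp (hrank.trans_lt (Module.rank_lt_aleph0 k K))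
  have hle : ∀ e ∈ compositeLT D.φ K, e ∈ M := by
    intro e he
    refine IntermediateField.adjoin_induction K (p := fun e _ => e ∈ M) ?_ ?_ ?_ ?_ ?_ he
    · exact fun x hx => M.algebraMap_mem ⟨x, hx⟩
    · exact fun x => IntermediateField.subset_adjoin E _ x.2
    · exact fun x y _ _ hx hy => add_mem hx hy
    · exact fun x _ hx => inv_mem hx
    · exact fun x y _ _ hx hy => mul_mem hx hy
  have h : FrobeniusFixed p (compositeLT D.φ K)
      (Nat.card (ResField p k) ^ (Module.finrank E M).factorial) := by
    rw [frobeniusFixed_iff]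
    intro e he
    refine norm_pow_sub_lt_one_of_natDegree_le (E := E) hf
      (IsTower.frobeniusFixed_lubinTateExt hD hπ ht) he ?_
    have := minpoly.natDegree_le (A := E) (⟨e, hle e e.2⟩ : M)
    rwa [← minpoly.algebraMap_eq (algebraMap M (PadicAlgCl p)).injective] at this
  exact h.finite (Nat.one_lt_pow (Nat.factorial_ne_zero _) (one_lt_natCard_resField p k))

/-- If `1 + p ^ c` lies in `χ_π(G_K)`, then the `p ^ c`-th power of the Frobenius map of the residue
field of `K k_π` is trivial on the residue field of `K̃`. -/
lemma frobeniusFixed_kummerExt (hD : D.φ = basicSeries D.π)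
    (hπ : IsLocalRing.maximalIdeal (IntRing p k) = Ideal.span {D.π})
    (K : IntermediateField k (PadicAlgCl p)) [Finite (ResField p (compositeLT D.φ K))]
    {c : ℕ} {u : (IntRing p k)ˣ} (hu : u ∈ lubinTateCharImage D.φ K)
    (huc : (u : IntRing p k) = 1 + (p : IntRing p k) ^ c) :
    FrobeniusFixed p (kummerExt D.φ K)
      (Nat.card (ResField p (compositeLT D.φ K)) ^ p ^ c) := by
  obtain ⟨t, ht⟩ := exists_isTower hD hπ
  obtain ⟨s, hsK, hs⟩ := hu
  rw [IsTower.lubinTateCharEq_iff hD hπ ht] at hs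
  have huc' : (u : IntRing p k) = ((1 + p ^ c : ℕ) : IntRing p k) := by
    rw [huc]; push_cast; rfl
  have hs' : ∀ (n : ℕ) (x : D.Point), D.π ^ n • x = 0 →
      gal s x = ((1 + p ^ c : ℕ) : IntRing p k) • x := by
    intro n x hx
    obtain ⟨a, rfl⟩ := IsTower.exists_smul_eq hD hπ ht n hx
    rw [gal_smul, hs, huc', smul_comm]
  rw [frobeniusFixed_iff]
  intro a ha
  set b := algebraMap (kummerExt D.φ K) (PadicAlgCl p) a with hb
  obtain ⟨h, hfix, hh⟩ := exists_algEquiv_pow_natCard_congr (compositeLT D.φ K) ha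
  -- On residues `h` is the Frobenius map, and `s h s⁻¹ = h ^ (1 + p ^ c)` is congruent to `h`.
  have hconj := conj_apply_eq_pow_apply (D := D) (K := K) (s := s) (h := h) (m := 1 + p ^ c)
    (fun x hx => hsK ⟨x, hx⟩)
    (fun x hx => hfix x ((compositeLT D.φ K).algebraMap_mem ⟨x, hx⟩)) hs'
    (fun n x hx => Point.ext (hfix _ (IntermediateField.subset_adjoin K _
      (IntermediateField.subset_adjoin k _ (Set.mem_iUnion.mpr
        ⟨n, mem_torsion_iff.mpr ⟨x, rfl, hx⟩⟩))))) a.2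
  have hcomm := norm_algEquiv_comm_lt_one s h (b := s⁻¹ b) (by rwa [norm_algEquiv])
  have h1 : s (h (s⁻¹ b)) = h ((h ^ p ^ c) b) := by
    rw [pow_add, pow_one] at hconj
    exact hconj
  have h2 : s (s⁻¹ b) = b := s.apply_symm_apply b
  rw [h1, h2, ← map_sub, norm_algEquiv] at hcomm
  refine norm_sub_lt_one_trans ?_ hcomm
  rw [norm_sub_rev]
  exact norm_pow_apply_sub_lt_one h ha hh _

lemma compositeLT_le_kummerExt (K : IntermediateField k (PadicAlgCl p)) :
    compositeLT D.φ K ≤ kummerExt D.φ K := by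
  refine IntermediateField.adjoin_le_iff.mpr fun x hx => ?_
  refine IntermediateField.adjoin_induction k (p := fun x _ => x ∈ kummerExt D.φ K)
    ?_ ?_ ?_ ?_ ?_ hx
  · intro x hx
    obtain ⟨n, hx⟩ := Set.mem_iUnion.mp hx
    obtain ⟨y, rfl, hy⟩ := mem_torsion_iff.mp hx
    refine IntermediateField.subset_adjoin K _ ⟨y.norm_lt, n + 1, Nat.succ_pos n, ?_⟩
    rw [← pi_pow_smul_val, pow_succ', mul_smul, hy, smul_zero]
    exact K.zero_mem
  · exact fun x => (kummerExt D.φ K).algebraMap_mem ⟨x, K.algebraMap_mem x⟩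
  · exact fun x y _ _ hx hy => add_mem hx hy
  · exact fun x _ hx => inv_mem hx
  · exact fun x y _ _ hx hy => mul_mem hx hy

lemma finite_and_finrank_dvd (hD : D.φ = basicSeries D.π)
    (hπ : IsLocalRing.maximalIdeal (IntRing p k) = Ideal.span {D.π})
    (K : IntermediateField k (PadicAlgCl p)) [FiniteDimensional k K]
    {c : ℕ} {u : (IntRing p k)ˣ} (hu : u ∈ lubinTateCharImage D.φ K)
    (huc : (u : IntRing p k) = 1 + (p : IntRing p k) ^ c) :
    Finite (ResField p (kummerExt D.φ K)) ∧
      Module.finrank (ResField p K) (ResField p (kummerExt D.φ K)) ∣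
        p ^ c * Module.finrank (ResField p K) (ResField p (compositeLT D.φ K)) := by
  have := finite_resField_compositeLT hD hπ K
  have hfix := frobeniusFixed_kummerExt hD hπ K hu huc
  have hfin : Finite (ResField p (kummerExt D.φ K)) :=
    hfix.finite (Nat.one_lt_pow (pow_ne_zero _ (Fact.out : p.Prime).ne_zero) Finite.one_lt_card)
  refine ⟨hfin, ?_⟩
  let : Algebra (compositeLT D.φ K) (kummerExt D.φ K) :=
    (IntermediateField.inclusion (compositeLT_le_kummerExt K)).toRingHom.toAlgebra
  have : IsScalarTower K (compositeLT D.φ K) (kummerExt D.φ K) :=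
    IsScalarTower.of_algebraMap_eq fun _ => rfl
  have : IsScalarTower (compositeLT D.φ K) (kummerExt D.φ K) (PadicAlgCl p) :=
    IsScalarTower.of_algebraMap_eq fun _ => rfl
  have : IsScalarTower (ResField p K) (ResField p (compositeLT D.φ K))
      (ResField p (kummerExt D.φ K)) := by
    refine IsScalarTower.of_algebraMap_eq fun x => ?_
    obtain ⟨x, rfl⟩ := IsLocalRing.residue_surjective x
    rfl
  exact finrank_dvd_mul_finrank (ResField p K) (ResField p (compositeLT D.φ K)) _ hfix

/-- The fields and the image of the character depend only on the uniformizer, so that the series may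
be replaced by `X ^ q + π X`. -/
lemma isLeast_and_finrank_dvd
    (hπ : IsLocalRing.maximalIdeal (IntRing p k) = Ideal.span {D.π})
    (K : IntermediateField k (PadicAlgCl p)) [FiniteDimensional k K] :
    Finite (ResField p (kummerExt D.φ K)) ∧ ∃ c : ℕ,
      IsLeast {t : ℕ | ∃ u ∈ lubinTateCharImage D.φ K,
        (u : IntRing p k) = 1 + (p : IntRing p k) ^ t} c ∧
      Module.finrank (ResField p K) (ResField p (kummerExt D.φ K)) ∣
        p ^ c * Module.finrank (ResField p K) (ResField p (compositeLT D.φ K)) := by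
  classical
  obtain ⟨D₀, h, hD₀⟩ : ∃ D₀ : LubinTateDatum k, D₀.π = D.π ∧ D₀.φ = basicSeries D₀.π :=
    ⟨⟨D.π, basicSeries D.π, D.base, isFrobeniusLift_basicSeries D.π⟩, rfl, rfl⟩
  rw [← h] at hπ
  have hcomp : compositeLT D.φ K = compositeLT D₀.φ K := by
    rw [compositeLT, le_antisymm (lubinTateExt_le h.symm) (lubinTateExt_le h), compositeLT]
  have hkum : kummerExt D.φ K = kummerExt D₀.φ K :=
    le_antisymm (kummerExt_le h.symm K) (kummerExt_le h K)
  have himage : lubinTateCharImage D.φ K = lubinTateCharImage D₀.φ K :=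
    (lubinTateCharImage_subset h.symm K).antisymm (lubinTateCharImage_subset h K)
  rw [hkum, hcomp, himage]
  have hex := exists_one_add_p_pow_mem hD₀ hπ K
  obtain ⟨u, hu, huc⟩ := Nat.find_spec hex
  obtain ⟨hfin, hdvd⟩ := finite_and_finrank_dvd hD₀ hπ K hu huc
  exact ⟨hfin, Nat.find hex, ⟨⟨u, hu, huc⟩, fun t ht => Nat.find_min' hex ht⟩, hdvd⟩

end LubinTateDatum

omit [FiniteDimensional ℚ_[p] k] in
lemma IsLubinTateSeries.isFrobeniusLift {π : IntRing p k} {φ : PowerSeries (IntRing p k)}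
    (hφ : IsLubinTateSeries π φ) : IsFrobeniusLift π (Nat.card (ResField p k)) φ := by
  have h := PowerSeries.X_pow_dvd_iff.mp hφ.2
  refine ⟨hφ.1, ?_, ?_⟩
  · simpa using h 0 (by norm_num)
  · have := h 1 (by norm_num)
    rwa [map_sub, PowerSeries.coeff_C_mul, PowerSeries.coeff_one_X, mul_one, sub_eq_zero] at this

end Main

end LubinTateKummer

end

theorem mainTheorem9 (p : ℕ) [Fact p.Prime]
    (k : IntermediateField ℚ_[p] (PadicAlgCl p)) [FiniteDimensional ℚ_[p] k]
    (K : IntermediateField k (PadicAlgCl p)) [FiniteDimensional k K]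
    (π : LubinTateKummer.IntRing p k)
    (hπ : IsLocalRing.maximalIdeal (LubinTateKummer.IntRing p k) = Ideal.span {π})
    (φ : PowerSeries (LubinTateKummer.IntRing p k))
    (hφ : LubinTateKummer.IsLubinTateSeries π φ) :
    Finite (LubinTateKummer.ResField p (LubinTateKummer.kummerExt φ K)) ∧
      ∃ c : ℕ,
        IsLeast {t : ℕ | ∃ u ∈ LubinTateKummer.lubinTateCharImage φ K,
          (u : LubinTateKummer.IntRing p k) = 1 + (p : LubinTateKummer.IntRing p k) ^ t} c ∧
        Module.finrank (LubinTateKummer.ResField p K)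
            (LubinTateKummer.ResField p (LubinTateKummer.kummerExt φ K)) ∣
          p ^ c * Module.finrank (LubinTateKummer.ResField p K)
            (LubinTateKummer.ResField p (LubinTateKummer.compositeLT φ K)) := by
  exact LubinTateKummer.LubinTateDatum.isLeast_and_finrank_dvd (D := ⟨π, φ,
    LubinTateKummer.isLubinTateBase_of_maximalIdeal_eq hπ, hφ.isFrobeniusLift⟩) hπ K
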